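/- Fix continuous or discrete time, and let $\mathbb C_g$ be, respectively, the open left half plane or the open unit disc of $\mathbb C$. Consider the real plant with state $x\in\mathcal X=\mathbb R^n$, control $u\in\mathcal U=\mathbb R^m$, disturbance $w\in\mathcal W=\mathbb R^q$, measurement $y\in\mathcal Y=\mathbb R^p$ and controlled output $z\in\mathcal Z=\mathbb R^r$, $$\mathcal D x=Ax+Bu+Hw,\qquad y=Cx+D_yu+G_yw,\qquad z=Ex+D_zu+G_zw,$$ where $\mathcal D$ is the time derivative or the unit shift. Assume that $(A,B)$ is asymptotically stabilizable and $(C,A)$ is asymptotically detectable, i.e. there are $F,G$ with $\sigma(A+BF)\subset\mathbb C_g$ and $\sigma(A+GC)\subset\mathbb C_g$. *The problem.* A compensator $\mathcal D\xi=A_c\xi+B_cy$, $u=C_c\xi+D_cy$ with $\xi\in\mathbb R^s$ (for some $s\in\mathbb N$) is well posed if $I-D_yD_c$ is non-singular. With $W_c=(I-D_yD_c)^{-1}$ the closed loop is then given by $$\widehat A=\begin{bmatrix}A+BD_cW_cC & BC_c+BD_cW_cD_yC_c\\ B_cW_cC & A_c+B_cW_cD_yC_c\end{bmatrix},\quad \widehat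 H=\begin{bmatrix}H+BD_cW_cG_y\\ B_cW_cG_y\end{bmatrix},$$ $$\widehat C=\begin{bmatrix}E+D_zD_cW_cC & D_zC_c+D_zD_cW_cD_yC_c\end{bmatrix},\quad \widehat G=G_z+D_zD_cW_cG_y .$$ The disturbance decoupling problem by dynamic output feedback with stability is *solvable* if there is a well posed compensator for which the transfer function $\widehat C(\lambda I-\widehat A)^{-1}\widehat H+\widehat G$ is identically zero and $\sigma(\widehat A)\subset\mathbb C_g$. *Subspaces.* For a real quadruple $(\mathsf A,\mathsf B,\mathsf C,\mathsf D)$ with state space $\mathcal X$, input space $\mathsf U$ and output space $\mathsf Y$: - A subspace $V\subseteq\mathcal X$ is output nulling if $\begin{bmatrix}\mathsf A\\ \mathsf C\end{bmatrix}V\subseteq (V\oplus 0_{\mathsf Y})+\operatorname{im}\begin{bmatrix}\mathsf B\\ \mathsf D\end{bmatrix}$. A friend of $V$ is a matrix $F$ with $\begin{bmatrix}\mathsf A+\mathsf BF\\ \mathsf C+\mathsf DF\end{bmatrix}V\subseteq V\oplus 0_{\mathsf Y}$. $V$ is internally stabilizable if $\sigma(\mathsf A+\mathsf BF\,|\,V)\subset\mathbb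 C_g$ for some friend $F$. $V$ is a reachability output nulling subspace if it is output nulling and every monic real polynomial of degree $\dim V$ is the characteristic polynomial of $\mathsf A+\mathsf BF\,|\,V$ for some friend $F$. - A subspace $S\subseteq\mathcal X$ is input containing if $[\mathsf A\ \mathsf B]\,\bigl((S\oplus\mathsf U)\cap\ker[\mathsf C\ \mathsf D]\bigr)\subseteq S$. A friend of $S$ is a matrix $G$ with $[\mathsf A+G\mathsf C\ \ \mathsf B+G\mathsf D]\,(S\oplus\mathsf U)\subseteq S$. $S$ is externally detectable if $\sigma(\mathsf A+G\mathsf C\,|\,\mathcal X/S)\subset\mathbb C_g$ for some friend $G$. $S$ is an unobservability input containing subspace if it is input containing and every monic real polynomial of degree $\dim\mathcal X/S$ is the characteristic polynomial of $\mathsf A+G\mathsf C\,|\,\mathcal X/S$ for some friend $G$. - $\mathcal V^\star$ is the largest output nulling subspace, $\mathcal S^\star$ the smallest input containing subspace, $\mathcal R^\star$ the largest reachability output nulling subspace and $\mathcal Q^\star$ the smallest unobservability input containing subspace; the quadruple is written as an index. Put $\mathcal V_m=\mathcal R^\star_{(A,[B\ H],E,[D_z\ G_z])}$ and $\mathcal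 S_M=\mathcal Q^\star_{\left(A,H,\left[\begin{smallmatrix}C\\E\end{smallmatrix}\right],\left[\begin{smallmatrix}G_y\\G_z\end{smallmatrix}\right]\right)}$. **Theorem.** The disturbance decoupling problem by dynamic output feedback with stability is solvable if and only if there exists $K\in\mathbb R^{m\times p}$ such that - **(A)** $\operatorname{im}\begin{bmatrix}H\\G_z\end{bmatrix}\subseteq(\mathcal V^\star_{(A,B,E,D_z)}\oplus 0_{\mathcal Z})+\operatorname{im}\begin{bmatrix}B\\D_z\end{bmatrix}$; - **(B)** $\ker[E\ G_z]\supseteq(\mathcal S^\star_{(A,H,C,G_y)}\oplus\mathcal W)\cap\ker[C\ G_y]$; - **(C)** $\mathcal S^\star_{(A,H,C,G_y)}\subseteq\mathcal V^\star_{(A,B,E,D_z)}$; - **(D)** $\mathcal V_m+\mathcal S_M$ is an internally stabilizable $(A,B,E,D_z)$-output nulling subspace; - **(E)** $\mathcal S_M$ is an externally detectable $(A,H,C,G_y)$-input containing subspace; - **(F)** $I+KD_y$ is non-singular and $$\begin{bmatrix}A+BKC & H+BKG_y\\ E+D_zKC & G_z+D_zKG_y\end{bmatrix}(\mathcal S^\star_{(A,H,C,G_y)}\oplus\mathcal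 W)\subseteq\mathcal V^\star_{(A,B,E,D_z)}\oplus 0_{\mathcal Z}.$$ -/

import Mathlib

namespace GeometricControl

/-! ### Time domains, stability regions, spectra -/

/-- The system evolves either in continuous or in discrete time. -/
inductive TimeDomain where
  | continuous
  | discrete

/-- The region `ℂ_g`: the open left half plane in continuous time, the open unit disc in
discrete time. -/
def TimeDomain.stableRegion : TimeDomain → Set ℂ
  | .continuous => {l : ℂ | l.re < 0}
  | .discrete => {l : ℂ | ‖l‖ < 1}

/-- The (complex) spectrum of an endomorphism of a finite-dimensional real vector space: the set
of complex roots of its characteristic polynomial. -/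
noncomputable def eigs {M : Type*} [AddCommGroup M] [Module ℝ M] [Module.Finite ℝ M]
    (f : Module.End ℝ M) : Set ℂ :=
  f.charpoly.rootSet ℂ

/-! ### Geometric notions for a quadruple `(A, B, C, D)`

The state space is `ι → ℝ`, the input space `μ → ℝ` and the output space `π → ℝ`. External direct
sums of subspaces are products `Submodule.prod`; column and row block maps are `LinearMap.prod`
and `LinearMap.coprod`. -/

section Quadruple

variable {ι μ π : Type*} [Fintype ι] [Fintype μ]

/-- `[A; C] V ⊆ (V ⊕ 0) + im [B; D]`. -/
def IsOutputNulling (A : Matrix ι ι ℝ) (B : Matrix ι μ ℝ) (C : Matrix π ι ℝ) (D : Matrix π μ ℝ)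
    (V : Submodule ℝ (ι → ℝ)) : Prop :=
  V.map (A.mulVecLin.prod C.mulVecLin) ≤
    V.prod (⊥ : Submodule ℝ (π → ℝ)) ⊔ LinearMap.range (B.mulVecLin.prod D.mulVecLin)

/-- `F` is an output nulling friend of `V`: `[A + B F; C + D F] V ⊆ V ⊕ 0`. -/
def IsOutputNullingFriend (A : Matrix ι ι ℝ) (B : Matrix ι μ ℝ) (C : Matrix π ι ℝ)
    (D : Matrix π μ ℝ) (V : Submodule ℝ (ι → ℝ)) (F : Matrix μ ι ℝ) : Prop :=
  V.map ((A + B * F).mulVecLin.prod (C + D * F).mulVecLin) ≤ V.prod (⊥ : Submodule ℝ (π → ℝ))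

/-- `[A B] ((S ⊕ U) ∩ ker [C D]) ⊆ S`. -/
def IsInputContaining (A : Matrix ι ι ℝ) (B : Matrix ι μ ℝ) (C : Matrix π ι ℝ)
    (D : Matrix π μ ℝ) (S : Submodule ℝ (ι → ℝ)) : Prop :=
  (S.prod (⊤ : Submodule ℝ (μ → ℝ)) ⊓ LinearMap.ker (C.mulVecLin.coprod D.mulVecLin)).map
    (A.mulVecLin.coprod B.mulVecLin) ≤ S

/-- `G` is an input containing friend of `S`: `[A + G C, B + G D] (S ⊕ U) ⊆ S`. -/
def IsInputContainingFriend [Fintype π] (A : Matrix ι ι ℝ) (B : Matrix ι μ ℝ) (C : Matrix π ι ℝ)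
    (D : Matrix π μ ℝ) (S : Submodule ℝ (ι → ℝ)) (G : Matrix ι π ℝ) : Prop :=
  (S.prod (⊤ : Submodule ℝ (μ → ℝ))).map
    ((A + G * C).mulVecLin.coprod (B + G * D).mulVecLin) ≤ S

/-- A friend `F` of `V` makes `V` an `(A + B F)`-invariant subspace. -/
theorem IsOutputNullingFriend.invariant {A : Matrix ι ι ℝ} {B : Matrix ι μ ℝ} {C : Matrix π ι ℝ}
    {D : Matrix π μ ℝ} {V : Submodule ℝ (ι → ℝ)} {F : Matrix μ ι ℝ}
    (h : IsOutputNullingFriend A B C D V F) : ∀ x ∈ V, (A + B * F).mulVecLin x ∈ V :=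
  fun _ hx => (h (Submodule.mem_map_of_mem hx)).1

/-- A friend `G` of `S` makes `S` an `(A + G C)`-invariant subspace. -/
theorem IsInputContainingFriend.invariant [Fintype π] {A : Matrix ι ι ℝ} {B : Matrix ι μ ℝ}
    {C : Matrix π ι ℝ} {D : Matrix π μ ℝ} {S : Submodule ℝ (ι → ℝ)} {G : Matrix ι π ℝ}
    (h : IsInputContainingFriend A B C D S G) : S ≤ S.comap (A + G * C).mulVecLin := by
  intro x hx
  have hm : ((x, 0) : (ι → ℝ) × (μ → ℝ)) ∈ S.prod (⊤ : Submodule ℝ (μ → ℝ)) := ⟨hx, trivial⟩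
  simpa using h (Submodule.mem_map_of_mem hm)

/-- The map `A + B F | V` induced on `V` by a friend `F` of `V`. -/
def IsOutputNullingFriend.restrict {A : Matrix ι ι ℝ} {B : Matrix ι μ ℝ} {C : Matrix π ι ℝ}
    {D : Matrix π μ ℝ} {V : Submodule ℝ (ι → ℝ)} {F : Matrix μ ι ℝ}
    (h : IsOutputNullingFriend A B C D V F) : Module.End ℝ V :=
  (A + B * F).mulVecLin.restrict h.invariant

/-- The map `A + G C | X / S` induced on the quotient by a friend `G` of `S`. -/
def IsInputContainingFriend.quotient [Fintype π] {A : Matrix ι ι ℝ} {B : Matrix ι μ ℝ} {C : Matrix π ι ℝ}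
    {D : Matrix π μ ℝ} {S : Submodule ℝ (ι → ℝ)} {G : Matrix ι π ℝ}
    (h : IsInputContainingFriend A B C D S G) : Module.End ℝ ((ι → ℝ) ⧸ S) :=
  S.mapQ S (A + G * C).mulVecLin h.invariant

/-- `V` is internally stabilizable: `σ(A + B F | V) ⊆ ℂ_g` for some output nulling friend `F`. -/
def IsInternallyStabilizable (τ : TimeDomain) (A : Matrix ι ι ℝ) (B : Matrix ι μ ℝ)
    (C : Matrix π ι ℝ) (D : Matrix π μ ℝ) (V : Submodule ℝ (ι → ℝ)) : Prop :=
  ∃ (F : Matrix μ ι ℝ) (h : IsOutputNullingFriend A B C D V F), eigs h.restrict ⊆ τ.stableRegion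

/-- `S` is externally detectable: `σ(A + G C | X / S) ⊆ ℂ_g` for some input containing
friend `G`. -/
def IsExternallyDetectable [Fintype π] (τ : TimeDomain) (A : Matrix ι ι ℝ) (B : Matrix ι μ ℝ)
    (C : Matrix π ι ℝ) (D : Matrix π μ ℝ) (S : Submodule ℝ (ι → ℝ)) : Prop :=
  ∃ (G : Matrix ι π ℝ) (h : IsInputContainingFriend A B C D S G),
    eigs h.quotient ⊆ τ.stableRegion

/-- `V` is a reachability output nulling subspace: it is output nulling and the spectrum of
`A + B F | V` can be assigned arbitrarily by the choice of an output nulling friend `F`, that is,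
every monic real polynomial of degree `dim V` is the characteristic polynomial of `A + B F | V`
for some friend `F`. -/
def IsReachabilityOutputNulling (A : Matrix ι ι ℝ) (B : Matrix ι μ ℝ) (C : Matrix π ι ℝ)
    (D : Matrix π μ ℝ) (V : Submodule ℝ (ι → ℝ)) : Prop :=
  IsOutputNulling A B C D V ∧
    ∀ P : Polynomial ℝ, P.Monic → P.natDegree = Module.finrank ℝ V →
      ∃ (F : Matrix μ ι ℝ) (h : IsOutputNullingFriend A B C D V F), h.restrict.charpoly = P

/-- `S` is an unobservability input containing subspace: it is input containing and the spectrum of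
`A + G C | X / S` can be assigned arbitrarily by the choice of an input containing friend `G`. -/
def IsUnobservabilityInputContaining [Fintype π] (A : Matrix ι ι ℝ) (B : Matrix ι μ ℝ) (C : Matrix π ι ℝ)
    (D : Matrix π μ ℝ) (S : Submodule ℝ (ι → ℝ)) : Prop :=
  IsInputContaining A B C D S ∧
    ∀ P : Polynomial ℝ, P.Monic → P.natDegree = Module.finrank ℝ ((ι → ℝ) ⧸ S) →
      ∃ (G : Matrix ι π ℝ) (h : IsInputContainingFriend A B C D S G), h.quotient.charpoly = P

/-- `V⋆`, the largest output nulling subspace. -/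
def Vstar (A : Matrix ι ι ℝ) (B : Matrix ι μ ℝ) (C : Matrix π ι ℝ) (D : Matrix π μ ℝ) :
    Submodule ℝ (ι → ℝ) :=
  sSup {V | IsOutputNulling A B C D V}

/-- `S⋆`, the smallest input containing subspace. -/
def Sstar (A : Matrix ι ι ℝ) (B : Matrix ι μ ℝ) (C : Matrix π ι ℝ) (D : Matrix π μ ℝ) :
    Submodule ℝ (ι → ℝ) :=
  sInf {S | IsInputContaining A B C D S}

/-- `R⋆`, the largest reachability output nulling subspace. -/
def Rstar (A : Matrix ι ι ℝ) (B : Matrix ι μ ℝ) (C : Matrix π ι ℝ) (D : Matrix π μ ℝ) :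
    Submodule ℝ (ι → ℝ) :=
  sSup {V | IsReachabilityOutputNulling A B C D V}

/-- `Q⋆`, the smallest unobservability input containing subspace. -/
def Qstar [Fintype π] (A : Matrix ι ι ℝ) (B : Matrix ι μ ℝ) (C : Matrix π ι ℝ) (D : Matrix π μ ℝ) :
    Submodule ℝ (ι → ℝ) :=
  sInf {S | IsUnobservabilityInputContaining A B C D S}

/-- The supremum defining `V⋆` is attained. -/
theorem isGreatest_Vstar (A : Matrix ι ι ℝ) (B : Matrix ι μ ℝ) (C : Matrix π ι ℝ)
    (D : Matrix π μ ℝ) : IsGreatest {V | IsOutputNulling A B C D V} (Vstar A B C D) := by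
  refine ⟨?_, fun V hV => le_sSup hV⟩
  change Submodule.map _ (sSup {V | IsOutputNulling A B C D V}) ≤ _
  rw [Submodule.map_le_iff_le_comap]
  refine sSup_le fun V hV => Submodule.map_le_iff_le_comap.1 (le_trans hV ?_)
  exact sup_le_sup_right (Submodule.prod_mono (le_sSup hV) le_rfl) _

/-- The infimum defining `S⋆` is attained. -/
theorem isLeast_Sstar (A : Matrix ι ι ℝ) (B : Matrix ι μ ℝ) (C : Matrix π ι ℝ)
    (D : Matrix π μ ℝ) : IsLeast {S | IsInputContaining A B C D S} (Sstar A B C D) := by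
  refine ⟨le_sInf fun S hS => le_trans (Submodule.map_mono ?_) hS, fun S hS => sInf_le hS⟩
  exact inf_le_inf_right _ (Submodule.prod_mono (sInf_le hS) le_rfl)

/-- The pair `(A, B)` is asymptotically stabilizable. -/
def IsStabilizable (τ : TimeDomain) (A : Matrix ι ι ℝ) (B : Matrix ι μ ℝ) : Prop :=
  ∃ F : Matrix μ ι ℝ, eigs (A + B * F).mulVecLin ⊆ τ.stableRegion

/-- The pair `(C, A)` is asymptotically detectable. -/
def IsDetectable [Fintype π] (τ : TimeDomain) (C : Matrix π ι ℝ) (A : Matrix ι ι ℝ) : Prop :=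
  ∃ G : Matrix ι π ℝ, eigs (A + G * C).mulVecLin ⊆ τ.stableRegion

end Quadruple

/-! ### The plant, the compensator and the closed loop -/

/-- The matrices of the plant
`𝒟x = A x + B u + H w`, `y = C x + D_y u + G_y w`, `z = E x + D_z u + G_z w`, with state in `ℝⁿ`,
control in `ℝᵐ`, disturbance in `ℝ^q`, measurement in `ℝᵖ` and controlled output in `ℝʳ`. -/
structure Plant (n m q p r : ℕ) where
  A : Matrix (Fin n) (Fin n) ℝ
  B : Matrix (Fin n) (Fin m) ℝ
  H : Matrix (Fin n) (Fin q) ℝ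
  C : Matrix (Fin p) (Fin n) ℝ
  Dy : Matrix (Fin p) (Fin m) ℝ
  Gy : Matrix (Fin p) (Fin q) ℝ
  E : Matrix (Fin r) (Fin n) ℝ
  Dz : Matrix (Fin r) (Fin m) ℝ
  Gz : Matrix (Fin r) (Fin q) ℝ

/-- The matrices of the regulator `𝒟p = A_c p + B_c y`, `u = C_c p + D_c y`, with state in `ℝˢ`. -/
structure Compensator (s m p : ℕ) where
  Ac : Matrix (Fin s) (Fin s) ℝ
  Bc : Matrix (Fin s) (Fin p) ℝ
  Cc : Matrix (Fin m) (Fin s) ℝ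
  Dc : Matrix (Fin m) (Fin p) ℝ

namespace Plant

variable {n m q p r s : ℕ} (P : Plant n m q p r) (K : Compensator s m p)

/-- The feedback interconnection is well posed: `I - D_y D_c` is non-singular. -/
def WellPosed : Prop := IsUnit (1 - P.Dy * K.Dc).det

/-- `W = (I - D_y D_c)⁻¹`. -/
noncomputable def W : Matrix (Fin p) (Fin p) ℝ := (1 - P.Dy * K.Dc)⁻¹

/-- The closed-loop state matrix. -/
noncomputable def Ahat : Matrix (Fin n ⊕ Fin s) (Fin n ⊕ Fin s) ℝ :=
  Matrix.fromBlocks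
    (P.A + P.B * K.Dc * P.W K * P.C) (P.B * K.Cc + P.B * K.Dc * P.W K * P.Dy * K.Cc)
    (K.Bc * P.W K * P.C) (K.Ac + K.Bc * P.W K * P.Dy * K.Cc)

/-- The closed-loop disturbance input matrix. -/
noncomputable def Hhat : Matrix (Fin n ⊕ Fin s) (Fin q) ℝ :=
  Matrix.fromRows (P.H + P.B * K.Dc * P.W K * P.Gy) (K.Bc * P.W K * P.Gy)

/-- The closed-loop output matrix. -/
noncomputable def Chat : Matrix (Fin r) (Fin n ⊕ Fin s) ℝ :=
  Matrix.fromCols (P.E + P.Dz * K.Dc * P.W K * P.C)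
    (P.Dz * K.Cc + P.Dz * K.Dc * P.W K * P.Dy * K.Cc)

/-- The closed-loop feedthrough matrix. -/
noncomputable def Ghat : Matrix (Fin r) (Fin q) ℝ := P.Gz + P.Dz * K.Dc * P.W K * P.Gy

/-- The spectrum of the closed-loop state matrix. -/
noncomputable def closedLoopSpectrum : Set ℂ := eigs (P.Ahat K).mulVecLin

/-- The value at `l` of the closed-loop transfer function `Ĉ (l I - Â)⁻¹ Ĥ + Ĝ`; it is meaningful
for `l` outside of the closed-loop spectrum. -/
noncomputable def transferFunction (l : ℂ) : Matrix (Fin r) (Fin q) ℂ :=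
  (P.Chat K).map (algebraMap ℝ ℂ) *
    (l • (1 : Matrix (Fin n ⊕ Fin s) (Fin n ⊕ Fin s) ℂ) - (P.Ahat K).map (algebraMap ℝ ℂ))⁻¹ *
      (P.Hhat K).map (algebraMap ℝ ℂ) + (P.Ghat K).map (algebraMap ℝ ℂ)

/-- The closed-loop transfer function matrix is zero. -/
def IsDecoupled : Prop := ∀ l : ℂ, l ∉ P.closedLoopSpectrum K → P.transferFunction K l = 0

/-- The disturbance decoupling problem by dynamic output feedback with stability is solvable. -/
def DDPStableSolvable (τ : TimeDomain) : Prop :=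
  ∃ (s : ℕ) (K : Compensator s m p),
    P.WellPosed K ∧ P.IsDecoupled K ∧ P.closedLoopSpectrum K ⊆ τ.stableRegion

/-- `V⋆` of the quadruple `(A, B, E, D_z)`. -/
def Vst : Submodule ℝ (Fin n → ℝ) := Vstar P.A P.B P.E P.Dz

/-- `S⋆` of the quadruple `(A, H, C, G_y)`. -/
def Sst : Submodule ℝ (Fin n → ℝ) := Sstar P.A P.H P.C P.Gy

/-- `V_m`, that is `R⋆` of the quadruple `(A, [B H], E, [D_z G_z])`. -/
def Vm : Submodule ℝ (Fin n → ℝ) :=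
  Rstar P.A (Matrix.fromCols P.B P.H) P.E (Matrix.fromCols P.Dz P.Gz)

/-- `S_M`, that is `Q⋆` of the quadruple `(A, H, [C; E], [G_y; G_z])`. -/
def SM : Submodule ℝ (Fin n → ℝ) :=
  Qstar P.A P.H (Matrix.fromRows P.C P.E) (Matrix.fromRows P.Gy P.Gz)

/-- The block matrix `[A + B K C, H + B K G_y; E + D_z K C, G_z + D_z K G_y]`, as a linear map
`X ⊕ W → X ⊕ Z`. -/
def feedbackBlock (K : Matrix (Fin m) (Fin p) ℝ) :
    (Fin n → ℝ) × (Fin q → ℝ) →ₗ[ℝ] (Fin n → ℝ) × (Fin r → ℝ) :=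
  ((P.A + P.B * K * P.C).mulVecLin.coprod (P.H + P.B * K * P.Gy).mulVecLin).prod
    ((P.E + P.Dz * K * P.C).mulVecLin.coprod (P.Gz + P.Dz * K * P.Gy).mulVecLin)

end Plant

end GeometricControl

/-!
A measurement `y = C x + D_y u + G_y w` determines, together with the control, the measurement that
the plant without `D_y` would give. Closing this loop inside the compensator replaces the
feedthrough `D_c` by `K = D_c (I - D_y D_c)⁻¹` and removes `D_y` (`Plant.loopShift`); the feedthroughs
`K` that arise in this way are those with `I + K D_y` non-singular. It remains to treat plants with
`D_y = 0`.

*Pole placement.* The characteristic polynomial of a reachable pair can be assigned by state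
feedback (`IsReachablePair.exists_charpoly_eq`). It follows that the largest reachability output
nulling subspace of a quadruple is `V⋆ ⊓ S⋆` (`Rstar_eq`), and by transposition that the smallest
unobservability input containing subspace is `S⋆ ⊔ V⋆` (`Qstar_eq`). So `V_m` is `V⋆` intersected
with the `S⋆` in which the disturbance acts as a control, and `S_M` is the sum of `S⋆` and the `V⋆`
in which the controlled output is measured.

*Stability.* A spectrum is located through annihilating polynomials: `stableSubspace Ω f` consists
of the vectors annihilated by `χ(f)` for some real polynomial `χ` with all roots in `Ω`, and a map
that intertwines two endomorphisms modulo stable vectors preserves stable vectors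
(`map_mem_stableSubspace`).

*Necessity.* A transfer function vanishes if and only if all Markov parameters do, so the unobservable
subspace of the closed loop contains the image of the disturbance. Its projection `V` to the plant
is output nulling and absorbs the disturbances, its intersection `S` with the plant is input
containing, and `S ≤ V`; the solvability conditions that do not involve stability follow. For the
internal stabilizability of `V_m ⊔ S_M`, a friend `F` of `V⋆` is fixed that is stable on `V⋆ ⊓ S⋆` of
`(A, B, E, D_z)`. All output nulling subspaces containing `V⋆ ⊓ S⋆` share this friend, so it suffices
to see that `V_m` and `S_M` consist of stable vectors of `A + B F`. The subspace `V` does, because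
there the feedback of the closed loop and `F` agree modulo `V⋆ ⊓ S⋆`; `V_m` does by its minimality
among the subspaces that absorb the disturbances (`Plant.Vm_le`); and on the second summand of `S_M`
a disturbance which the measurement does not see acts as a feedback that the closed loop follows
(`Plant.IsDecouplingLoop.Vext_le_stableSubspace`). The external detectability of `S_M` is dual to
the internal stabilizability of `V_m`.

*Sufficiency.* With `V = V_m ⊔ S_M` and `S = S_M`, the feedback `K` steers `S` into `V`
(`Plant.steers_SM`). Since the plant is stabilizable and detectable, stabilizing friends `F` of `V`
and `G` of `S` can be chosen that stabilize the whole state space. The observer with state feedback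
`F`, output injection `G` and feedthrough `K` keeps the plant state in `V` and the estimation error
in `S`, so that the controlled output stays zero, and it is stable by the separation principle.
-/

namespace GeometricControl

open Polynomial

/-! ### Stable subspaces of an endomorphism -/

/-- A monic real polynomial is stable with respect to a region `Ω` of the complex plane if all of
its complex roots lie in `Ω`. -/
def IsStablePoly (Ω : Set ℂ) (χ : ℝ[X]) : Prop :=
  χ.Monic ∧ ∀ z : ℂ, aeval z χ = 0 → z ∈ Ω

theorem IsStablePoly.mul {Ω : Set ℂ} {χ ψ : ℝ[X]} (h₁ : IsStablePoly Ω χ)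
    (h₂ : IsStablePoly Ω ψ) : IsStablePoly Ω (χ * ψ) := by
  refine ⟨h₁.1.mul h₂.1, fun z hz => ?_⟩
  rw [map_mul, mul_eq_zero] at hz
  exact hz.elim (h₁.2 z) (h₂.2 z)

theorem isStablePoly_one (Ω : Set ℂ) : IsStablePoly Ω 1 :=
  ⟨monic_one, fun z hz => by simp at hz⟩

section StableSubspace

variable {X Y : Type*} [AddCommGroup X] [Module ℝ X] [AddCommGroup Y] [Module ℝ Y]

/-- The vectors annihilated by `χ(f)` for some polynomial `χ` that is stable with respect to `Ω`;
in finite dimension, and for a region `Ω` that is invariant under conjugation, this is the real part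
of the sum of the generalized eigenspaces of `f` for the eigenvalues in `Ω`. -/
def stableSubspace (Ω : Set ℂ) (f : Module.End ℝ X) : Submodule ℝ X where
  carrier := {x | ∃ χ : ℝ[X], IsStablePoly Ω χ ∧ aeval f χ x = 0}
  add_mem' := by
    rintro x y ⟨χ, hχ, hx⟩ ⟨ψ, hψ, hy⟩
    refine ⟨χ * ψ, hχ.mul hψ, ?_⟩
    have h₁ : aeval f (χ * ψ) x = 0 := by
      rw [mul_comm, map_mul, Module.End.mul_apply, hx, map_zero]
    have h₂ : aeval f (χ * ψ) y = 0 := by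
      rw [map_mul, Module.End.mul_apply, hy, map_zero]
    rw [map_add, h₁, h₂, add_zero]
  zero_mem' := ⟨1, isStablePoly_one Ω, map_zero _⟩
  smul_mem' := by
    rintro c x ⟨χ, hχ, hx⟩
    exact ⟨χ, hχ, by rw [map_smul, hx, smul_zero]⟩

theorem aeval_mem_of_invariant {f : Module.End ℝ X} {V : Submodule ℝ X}
    (hV : ∀ x ∈ V, f x ∈ V) (χ : ℝ[X]) {x : X} (hx : x ∈ V) : aeval f χ x ∈ V := by
  induction χ using Polynomial.induction_on' with
  | add p q hp hq => rw [map_add]; exact V.add_mem hp hq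
  | monomial k c =>
    rw [aeval_monomial, Module.End.mul_apply, Module.algebraMap_end_apply]
    refine V.smul_mem _ ?_
    induction k with
    | zero => simpa using hx
    | succ k ih => rw [pow_succ', Module.End.mul_apply]; exact hV _ ih

theorem stableSubspace_invariant (Ω : Set ℂ) (f : Module.End ℝ X) :
    ∀ x ∈ stableSubspace Ω f, f x ∈ stableSubspace Ω f := by
  rintro x ⟨χ, hχ, hx⟩
  refine ⟨χ, hχ, ?_⟩
  have : aeval f χ (f x) = (aeval f (χ * Polynomial.X)) x := by simp
  rw [this, mul_comm]
  simp [hx]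

theorem mem_stableSubspace_of_aeval_mem {Ω : Set ℂ} {f : Module.End ℝ X} {χ : ℝ[X]} {x : X}
    (hχ : IsStablePoly Ω χ) (h : aeval f χ x ∈ stableSubspace Ω f) :
    x ∈ stableSubspace Ω f := by
  obtain ⟨ψ, hψ, hx⟩ := h
  exact ⟨ψ * χ, hψ.mul hχ, by rw [map_mul, Module.End.mul_apply, hx]⟩

/-- A map that intertwines `f` and `g` modulo a `g`-invariant subspace intertwines `χ(f)` and
`χ(g)` modulo the same subspace. -/
theorem intertwine_aeval {f : Module.End ℝ X} {g : Module.End ℝ Y} {φ : X →ₗ[ℝ] Y}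
    {L : Submodule ℝ Y} (hL : ∀ y ∈ L, g y ∈ L) (h : ∀ x, φ (f x) - g (φ x) ∈ L)
    (χ : ℝ[X]) (x : X) : φ (aeval f χ x) - aeval g χ (φ x) ∈ L := by
  induction χ using Polynomial.induction_on' with
  | add p q hp hq =>
    have := L.add_mem hp hq
    simp only [map_add, LinearMap.add_apply]
    convert this using 1
    abel
  | monomial k c =>
    rw [aeval_monomial, aeval_monomial, Module.End.mul_apply, Module.algebraMap_end_apply,
      Module.End.mul_apply, Module.algebraMap_end_apply, map_smul, ← smul_sub]
    refine L.smul_mem _ ?_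
    induction k with
    | zero => simp
    | succ k ih =>
      rw [pow_succ', pow_succ', Module.End.mul_apply, Module.End.mul_apply]
      have := L.add_mem (h ((f ^ k) x)) (hL _ ih)
      rw [map_sub] at this
      convert this using 1
      abel

theorem map_mem_stableSubspace {Ω : Set ℂ} {f : Module.End ℝ X} {g : Module.End ℝ Y}
    {φ : X →ₗ[ℝ] Y} (h : ∀ x, φ (f x) - g (φ x) ∈ stableSubspace Ω g) {x : X}
    (hx : x ∈ stableSubspace Ω f) : φ x ∈ stableSubspace Ω g := by
  obtain ⟨χ, hχ, hx⟩ := hx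
  have := intertwine_aeval (stableSubspace_invariant Ω g) h χ x
  rw [hx, map_zero, zero_sub, neg_mem_iff] at this
  exact mem_stableSubspace_of_aeval_mem hχ this

/-- Polynomials that annihilate an endomorphism vanish on its spectrum. -/
theorem aeval_eq_zero_of_mem_eigs [Module.Finite ℝ X] {f : Module.End ℝ X} {χ : ℝ[X]}
    (hχ : aeval f χ = 0) {z : ℂ} (hz : z ∈ eigs f) : aeval z χ = 0 := by
  have hr := aeval_eq_zero_of_mem_rootSet hz
  rw [← LinearMap.charpoly_toMatrix f (Module.finBasis ℝ X)] at hr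
  set M := LinearMap.toMatrix (Module.finBasis ℝ X) (Module.finBasis ℝ X) f
  have hM : aeval M χ = 0 := by
    have h2 : LinearMap.toMatrixAlgEquiv (Module.finBasis ℝ X) f = M := rfl
    rw [← h2, aeval_algEquiv, AlgHom.comp_apply, hχ, map_zero]
  have hroot : ((M.map (algebraMap ℝ ℂ)).charpoly).IsRoot z := by
    rw [Matrix.charpoly_map, IsRoot.def, eval_map, ← aeval_def]
    exact hr
  have hspec := Matrix.mem_spectrum_of_isRoot_charpoly hroot
  have hzero : aeval (M.map (algebraMap ℝ ℂ)) χ = 0 := by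
    have h3 : (Algebra.ofId ℝ ℂ).mapMatrix M = M.map (algebraMap ℝ ℂ) := rfl
    rw [← h3, aeval_algHom_apply, hM, map_zero]
  have hzero' : aeval (M.map (algebraMap ℝ ℂ)) (χ.map (algebraMap ℝ ℂ)) = 0 := by
    rw [aeval_map_algebraMap, hzero]
  have := spectrum.subset_polynomial_aeval (M.map (algebraMap ℝ ℂ)) (χ.map (algebraMap ℝ ℂ))
    ⟨z, hspec, rfl⟩
  rw [hzero', spectrum.mem_iff] at this
  simp only [sub_zero, eval_map, ← aeval_def] at this
  by_contra hne
  exact this ((IsUnit.mk0 _ hne).map _)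

theorem isStablePoly_charpoly [Module.Finite ℝ X] {Ω : Set ℂ} {f : Module.End ℝ X}
    (h : eigs f ⊆ Ω) : IsStablePoly Ω f.charpoly :=
  ⟨f.charpoly_monic, fun _ hz => h (mem_rootSet.2 ⟨f.charpoly_monic.ne_zero, hz⟩)⟩

/-- The spectrum of `f` lies in `Ω` if and only if every vector is stable. -/
theorem eigs_subset_iff [Module.Finite ℝ X] {Ω : Set ℂ} {f : Module.End ℝ X} :
    eigs f ⊆ Ω ↔ stableSubspace Ω f = ⊤ := by
  refine ⟨fun h => ?_, fun h => ?_⟩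
  · rw [eq_top_iff]
    exact fun x _ => ⟨f.charpoly, isStablePoly_charpoly h, by simp [f.aeval_self_charpoly]⟩
  · intro z hz
    -- The product of the polynomials belonging to a finite basis annihilates `f`.
    have key : ∀ s : Finset X, ∃ χ : ℝ[X], IsStablePoly Ω χ ∧ ∀ x ∈ s, aeval f χ x = 0 := by
      classical
      intro s
      induction s using Finset.induction_on with
      | empty => exact ⟨1, isStablePoly_one Ω, by simp⟩
      | insert a s _ ih =>
        obtain ⟨χ, hχ, hs⟩ := ih
        obtain ⟨ψ, hψ, ha⟩ : a ∈ stableSubspace Ω f := h ▸ Submodule.mem_top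
        refine ⟨χ * ψ, hχ.mul hψ, fun x hx => ?_⟩
        rcases Finset.mem_insert.1 hx with rfl | hx
        · simp [ha]
        · rw [mul_comm]; simp [hs x hx]
    obtain ⟨s, hs⟩ := (Module.finite_def.1 ‹Module.Finite ℝ X› : (⊤ : Submodule ℝ X).FG)
    obtain ⟨χ, hχ, h0⟩ := key s
    have : aeval f χ = 0 := by
      have hle : (⊤ : Submodule ℝ X) ≤ LinearMap.ker (aeval f χ) := by
        rw [← hs, Submodule.span_le]
        exact fun x hx => h0 x hx
      exact LinearMap.ext fun x => hle Submodule.mem_top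
    exact hχ.2 z (aeval_eq_zero_of_mem_eigs this hz)

/-- The restriction of `f` to an invariant subspace `V` is stable if and only if `V` consists of
stable vectors of `f`. -/
theorem eigs_restrict_subset_iff [Module.Finite ℝ X] {Ω : Set ℂ} {f : Module.End ℝ X}
    {V : Submodule ℝ X} (hV : ∀ x ∈ V, f x ∈ V) :
    eigs (f.restrict hV) ⊆ Ω ↔ V ≤ stableSubspace Ω f := by
  have hcomm : ∀ (χ : ℝ[X]) (x : V), (aeval (f.restrict hV) χ x : X) = aeval f χ x := by
    intro χ x
    have := intertwine_aeval (f := f.restrict hV) (g := f) (φ := V.subtype) (L := ⊥)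
      (by simp) (by simp) χ x
    simpa [sub_eq_zero] using this
  rw [eigs_subset_iff, eq_top_iff]
  refine ⟨fun h x hx => ?_, fun h x _ => ?_⟩
  · obtain ⟨χ, hχ, h0⟩ := h (Submodule.mem_top : (⟨x, hx⟩ : V) ∈ ⊤)
    exact ⟨χ, hχ, by rw [← hcomm χ ⟨x, hx⟩, h0]; rfl⟩
  · obtain ⟨χ, hχ, h0⟩ := h x.2
    exact ⟨χ, hχ, Subtype.ext (by rw [hcomm, h0]; rfl)⟩

end StableSubspace

/-- Both stability regions contain a real number. -/
theorem exists_isStablePoly (τ : TimeDomain) (d : ℕ) :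
    ∃ χ : ℝ[X], IsStablePoly τ.stableRegion χ ∧ χ.natDegree = d := by
  cases τ with
  | continuous =>
    refine ⟨(X - C (-1)) ^ d, ⟨(monic_X_sub_C _).pow d, fun z hz => ?_⟩,
      by rw [natDegree_pow, natDegree_X_sub_C, mul_one]⟩
    have : z - ((-1 : ℝ) : ℂ) = 0 := by
      have := eq_zero_of_pow_eq_zero (by simpa using hz : (z + 1) ^ d = 0)
      simpa using this
    rw [sub_eq_zero] at this
    subst this
    simp [TimeDomain.stableRegion]
  | discrete =>
    refine ⟨X ^ d, ⟨monic_X_pow d, fun z hz => ?_⟩, by simp⟩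
    have : z = 0 := eq_zero_of_pow_eq_zero (by simpa using hz)
    subst this
    simp [TimeDomain.stableRegion]

/-! ### Pole placement -/

section PolePlacement

variable {X U : Type*} [AddCommGroup X] [Module ℝ X] [AddCommGroup U] [Module ℝ U]

theorem exists_linearMap_eq_of_linearIndependent {κ : Type*} {v : κ → X}
    (hv : LinearIndependent ℝ v) (c : κ → U) : ∃ φ : X →ₗ[ℝ] U, ∀ i, φ (v i) = c i := by
  obtain ⟨φ, hφ⟩ := LinearMap.exists_extend ((Module.Basis.span hv).constr ℝ c)
  refine ⟨φ, fun i => ?_⟩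
  have := LinearMap.congr_fun hφ (Module.Basis.span hv i)
  rw [(Module.Basis.span hv).constr_basis] at this
  rw [← this]
  simp [Module.Basis.span_apply]

/-- The pair `(a, b)` is reachable: no proper `a`-invariant subspace contains the range of `b`. -/
def IsReachablePair (a : Module.End ℝ X) (b : U →ₗ[ℝ] X) : Prop :=
  ∀ V : Submodule ℝ X, LinearMap.range b ≤ V → (∀ x ∈ V, a x ∈ V) → V = ⊤

/-- Heymann's lemma: a suitable feedback turns a given non-zero vector `b u₀` of the range of `b`
into a cyclic vector. The cyclic chain is lengthened one vector at a time: when it closes up on a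
proper subspace, the feedback is changed on its last vector by an input that leaves the
subspace. -/
theorem exists_feedback_cyclic [Module.Finite ℝ X] {a : Module.End ℝ X} {b : U →ₗ[ℝ] X}
    (h : IsReachablePair a b) {u₀ : U} (hu₀ : b u₀ ≠ 0) (k : ℕ) (hk : k ≤ Module.finrank ℝ X) :
    ∃ f : X →ₗ[ℝ] U, LinearIndependent ℝ
      (fun i : Fin k => ((a + b ∘ₗ f : Module.End ℝ X) ^ (i : ℕ)) (b u₀)) := by
  induction k with
  | zero => exact ⟨0, linearIndependent_empty_type⟩
  | succ k ih =>
    obtain ⟨f, hf⟩ := ih (by omega)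
    set g : Module.End ℝ X := a + b ∘ₗ f with hg
    set L := Submodule.span ℝ (Set.range fun i : Fin k => (g ^ (i : ℕ)) (b u₀)) with hL
    have hmem : ∀ i < k, (g ^ i) (b u₀) ∈ L := fun i hi => Submodule.subset_span ⟨⟨i, hi⟩, rfl⟩
    by_cases hx : (g ^ k) (b u₀) ∈ L
    swap
    · exact ⟨f, linearIndependent_finSucc'.2 ⟨hf, hx⟩⟩
    cases k with
    | zero => simp [hL] at hx; exact absurd hx hu₀
    | succ j =>
      have hLinv : ∀ x ∈ L, g x ∈ L := by
        intro x hxL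
        have : L ≤ L.comap g := by
          rw [hL, Submodule.span_le]
          rintro _ ⟨i, rfl⟩
          change g ((g ^ (i : ℕ)) (b u₀)) ∈ L
          rw [← Module.End.mul_apply, ← pow_succ']
          rcases Nat.lt_or_ge ((i : ℕ) + 1) (j + 1) with h1 | h1
          · exact hmem _ h1
          · have : (i : ℕ) + 1 = j + 1 := by omega
            rw [this]; exact hx
        exact this hxL
      obtain ⟨u, hu⟩ : ∃ u, b u ∉ L := by
        by_contra! hcon
        have htop : L = ⊤ := by
          refine h L ?_ fun x hxL => ?_
          · rintro _ ⟨u, rfl⟩; exact hcon u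
          · have : a x = g x - b (f x) := by simp [hg]
            rw [this]; exact L.sub_mem (hLinv x hxL) (hcon _)
        have hcard := finrank_span_eq_card hf
        rw [← hL, htop, finrank_top, Fintype.card_fin] at hcard
        omega
      obtain ⟨φ, hφ⟩ := exists_linearMap_eq_of_linearIndependent hf
        (fun i : Fin (j + 1) => if (i : ℕ) = j then (1 : ℝ) else 0)
      have hφ' : ∀ i < j + 1, φ ((g ^ i) (b u₀)) = if i = j then 1 else 0 :=
        fun i hi => hφ ⟨i, hi⟩
      set g' : Module.End ℝ X := a + b ∘ₗ (f + φ.smulRight u) with hg'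
      have hgg : ∀ x, g' x = g x + φ x • b u := by
        intro x; simp [hg, hg', add_assoc]
      have hpow : ∀ i < j + 1, (g' ^ i) (b u₀) = (g ^ i) (b u₀) := by
        intro i
        induction i with
        | zero => simp
        | succ i ih =>
          intro hi
          rw [pow_succ', Module.End.mul_apply, ih (by omega), hgg, hφ' i (by omega),
            if_neg (by omega), zero_smul, add_zero, pow_succ', Module.End.mul_apply]
      have hlast : (g' ^ (j + 1)) (b u₀) = (g ^ (j + 1)) (b u₀) + b u := by
        rw [pow_succ', Module.End.mul_apply, hpow j (by omega), hgg, hφ' j (by omega),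
          if_pos rfl, one_smul, pow_succ', Module.End.mul_apply]
      have hinit : (Fin.init fun i : Fin (j + 1 + 1) => (g' ^ (i : ℕ)) (b u₀)) =
          fun i : Fin (j + 1) => (g ^ (i : ℕ)) (b u₀) := by
        funext i
        exact hpow i i.2
      refine ⟨f + φ.smulRight u, linearIndependent_finSucc'.2 ⟨?_, ?_⟩⟩
      · rw [← hg', hinit]; exact hf
      · rw [← hg', hinit, ← hL]
        simp only [Fin.val_last]
        rw [hlast]
        intro hcon
        exact hu ((Submodule.add_mem_iff_right L hx).1 hcon)

/-- Ackermann's formula: if `v` is a cyclic vector of `g` and `l` is the functional dual to the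
last vector of the cyclic basis, then `g - v ⊗ (l ∘ P(g))` has the characteristic polynomial `P`. -/
theorem exists_charpoly_rankOne_update [Module.Finite ℝ X] {g : Module.End ℝ X} {v : X}
    (hv : LinearIndependent ℝ (fun i : Fin (Module.finrank ℝ X) => (g ^ (i : ℕ)) v))
    {P : ℝ[X]} (hP : P.Monic) (hdeg : P.natDegree = Module.finrank ℝ X) :
    ∃ φ : X →ₗ[ℝ] ℝ, LinearMap.charpoly (g + φ.smulRight v : Module.End ℝ X) = P := by
  obtain ⟨n, hn⟩ : ∃ n, Module.finrank ℝ X = n := ⟨_, rfl⟩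
  rw [hn] at hv hdeg
  cases n with
  | zero =>
    refine ⟨0, ?_⟩
    rw [hP.natDegree_eq_zero.1 hdeg, ← (LinearMap.charpoly_monic _).natDegree_eq_zero,
      LinearMap.charpoly_natDegree, hn]
  | succ n =>
    obtain ⟨l, hl⟩ := exists_linearMap_eq_of_linearIndependent hv
      (fun i : Fin (n + 1) => if (i : ℕ) = n then (1 : ℝ) else 0)
    have hl' : ∀ i < n + 1, l ((g ^ i) v) = if i = n then 1 else 0 := fun i hi => hl ⟨i, hi⟩
    set φ : X →ₗ[ℝ] ℝ := -(l ∘ₗ aeval g P) with hφ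
    set T : Module.End ℝ X := g + φ.smulRight v with hT
    have hTx : ∀ x, T x = g x + φ x • v := fun x => by simp [hT]
    have hpow : ∀ i < n + 1, ∀ x, l ((T ^ i) x) = l ((g ^ i) x) := by
      intro i
      induction i with
      | zero => simp
      | succ i ih =>
        intro hi x
        rw [pow_succ, Module.End.mul_apply, ih (by omega), hTx, map_add, map_add, map_smul,
          map_smul, hl' i (by omega), if_neg (by omega), smul_zero, add_zero, pow_succ,
          Module.End.mul_apply]
    have hlast : ∀ x, l ((T ^ (n + 1)) x) = l ((g ^ (n + 1)) x) - l (aeval g P x) := by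
      intro x
      rw [pow_succ, Module.End.mul_apply, hpow n (by omega), hTx, map_add, map_add, map_smul,
        map_smul, hl' n (by omega), if_pos rfl, pow_succ, Module.End.mul_apply, hφ]
      simp [sub_eq_add_neg]
    have hexp : ∀ (f : Module.End ℝ X) (x : X), l (aeval f P x) =
        l ((f ^ (n + 1)) x) + ∑ i ∈ Finset.range (n + 1), P.coeff i * l ((f ^ i) x) := by
      intro f x
      conv_lhs => rw [hP.as_sum, hdeg]
      simp [map_sum, LinearMap.sum_apply]
    have hlP : ∀ x, l (aeval T P x) = 0 := by
      intro x
      have hsum : ∑ i ∈ Finset.range (n + 1), P.coeff i * l ((T ^ i) x) =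
          ∑ i ∈ Finset.range (n + 1), P.coeff i * l ((g ^ i) x) :=
        Finset.sum_congr rfl fun i hi => by rw [hpow i (Finset.mem_range.1 hi)]
      rw [hexp, hlast, hexp g, hsum]
      ring
    have hlTP : ∀ i x, l ((T ^ i) (aeval T P x)) = 0 := by
      intro i x
      have : (T ^ i) (aeval T P x) = aeval T P ((T ^ i) x) := by
        have h1 : aeval T (Polynomial.X ^ i * P) x = aeval T (P * Polynomial.X ^ i) x := by
          rw [mul_comm]
        simpa using h1
      rw [this, hlP]
    -- The Hankel matrix of the numbers `l (g ^ (i + j) v)` is anti-triangular with unit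
    -- antidiagonal, so the functionals `l ∘ g ^ i` separate points.
    have hsep : ∀ d ≤ n + 1, ∀ c : ℕ → ℝ,
        (∀ i < n + 1, l ((g ^ i) (∑ j ∈ Finset.range d, c j • (g ^ j) v)) = 0) →
        ∑ j ∈ Finset.range d, c j • (g ^ j) v = 0 := by
      intro d
      induction d with
      | zero => simp
      | succ d ih =>
        intro hd c hc
        have hcd : c d = 0 := by
          have := hc (n - d) (by omega)
          rw [map_sum, map_sum, Finset.sum_range_succ, Finset.sum_eq_zero, zero_add] at this
          · rw [map_smul, map_smul, ← Module.End.mul_apply, ← pow_add,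
              show n - d + d = n by omega, hl' n (by omega)] at this
            simpa using this
          · intro j hj
            have hj := Finset.mem_range.1 hj
            rw [map_smul, map_smul, ← Module.End.mul_apply, ← pow_add,
              hl' _ (by omega), if_neg (by omega), smul_zero]
        rw [Finset.sum_range_succ, hcd, zero_smul, add_zero] at hc ⊢
        exact ih (by omega) c hc
    have hPT : aeval T P = 0 := by
      refine LinearMap.ext fun x => ?_
      have hspan : Submodule.span ℝ (Set.range fun i : Fin (n + 1) => (g ^ (i : ℕ)) v) = ⊤ :=
        hv.span_eq_top_of_card_eq_finrank' (by simp [hn])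
      obtain ⟨c, hc⟩ := (Submodule.mem_span_range_iff_exists_fun ℝ).1
        (hspan ▸ Submodule.mem_top : aeval T P x ∈ _)
      have hc' : ∑ j ∈ Finset.range (n + 1),
          (fun j => if hj : j < n + 1 then c ⟨j, hj⟩ else 0) j • (g ^ j) v = aeval T P x := by
        rw [← hc, Finset.sum_range]
        exact Finset.sum_congr rfl fun i _ => by beta_reduce; rw [dif_pos i.2]
      rw [← hc', LinearMap.zero_apply]
      refine hsep _ le_rfl _ fun i hi => ?_
      rw [hc', ← hpow i hi, hlTP]
    have hint : IsIntegral ℝ T := Algebra.IsIntegral.isIntegral T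
    have hmin : n + 1 ≤ (minpoly ℝ T).natDegree := by
      by_contra! hlt
      set Q := minpoly ℝ T
      have hQ : l (aeval T Q ((g ^ (n - Q.natDegree)) v)) = 0 := by
        rw [minpoly.aeval]; simp
      rw [aeval_eq_sum_range, LinearMap.sum_apply, map_sum, Finset.sum_range_succ,
        Finset.sum_eq_zero, zero_add] at hQ
      · rw [LinearMap.smul_apply, map_smul, hpow _ hlt, ← Module.End.mul_apply, ← pow_add,
          show Q.natDegree + (n - Q.natDegree) = n by omega, hl' n (by omega), if_pos rfl,
          coeff_natDegree, (minpoly.monic hint).leadingCoeff] at hQ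
        simp at hQ
      · intro j hj
        have hj := Finset.mem_range.1 hj
        rw [LinearMap.smul_apply, map_smul, hpow _ (by omega), ← Module.End.mul_apply, ← pow_add,
          hl' _ (by omega), if_neg (by omega), smul_zero]
    refine ⟨φ, ?_⟩
    rw [← hT]
    rw [eq_of_monic_of_dvd_of_natDegree_le (minpoly.monic hint) hP (minpoly.dvd ℝ T hPT)
      (by omega)]
    exact eq_of_monic_of_dvd_of_natDegree_le (minpoly.monic hint) T.charpoly_monic
      T.minpoly_dvd_charpoly (by rw [LinearMap.charpoly_natDegree, hn]; exact hmin)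

/-- The pole placement theorem: the characteristic polynomial of a reachable pair can be assigned
arbitrarily by state feedback. -/
theorem IsReachablePair.exists_charpoly_eq [Module.Finite ℝ X] {a : Module.End ℝ X}
    {b : U →ₗ[ℝ] X} (h : IsReachablePair a b) {P : ℝ[X]} (hP : P.Monic)
    (hdeg : P.natDegree = Module.finrank ℝ X) :
    ∃ f : X →ₗ[ℝ] U, LinearMap.charpoly (a + b ∘ₗ f : Module.End ℝ X) = P := by
  by_cases hb : ∃ u₀, b u₀ ≠ 0
  · obtain ⟨u₀, hu₀⟩ := hb
    obtain ⟨f, hf⟩ := exists_feedback_cyclic h hu₀ _ le_rfl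
    obtain ⟨φ, hφ⟩ := exists_charpoly_rankOne_update hf hP hdeg
    refine ⟨f + φ.smulRight u₀, ?_⟩
    rw [← hφ]
    congr 1
    ext x
    simp [add_assoc]
  · push Not at hb
    have htop : (⊥ : Submodule ℝ X) = ⊤ :=
      h ⊥ (by rintro _ ⟨u, rfl⟩; simp [hb u]) (by simp)
    have h0 : Module.finrank ℝ X = 0 := by rw [← finrank_top ℝ X, ← htop, finrank_bot]
    refine ⟨0, ?_⟩
    rw [hP.natDegree_eq_zero.1 (hdeg.trans h0),
      ← (LinearMap.charpoly_monic _).natDegree_eq_zero, LinearMap.charpoly_natDegree, h0]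

/-- Some feedback makes every vector of the range of `b` stable: poles are placed on the reachable
subspace. -/
theorem exists_feedback_range_le_stableSubspace [Module.Finite ℝ X] (τ : TimeDomain)
    (a : Module.End ℝ X) (b : U →ₗ[ℝ] X) :
    ∃ f : X →ₗ[ℝ] U, LinearMap.range b ≤ stableSubspace τ.stableRegion (a + b ∘ₗ f) := by
  set R : Submodule ℝ X := sInf {V | LinearMap.range b ≤ V ∧ ∀ x ∈ V, a x ∈ V} with hR
  have hbR : ∀ u, b u ∈ R := by
    intro u
    rw [hR, Submodule.mem_sInf]
    exact fun V hV => hV.1 ⟨u, rfl⟩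
  have haR : ∀ x ∈ R, a x ∈ R := by
    intro x hx
    rw [hR, Submodule.mem_sInf] at hx ⊢
    exact fun V hV => hV.2 x (hx V hV)
  have hreach : IsReachablePair (a.restrict haR) (b.codRestrict R hbR) := by
    intro V hbV haV
    rw [eq_top_iff]
    have hle : R ≤ V.map R.subtype := by
      refine sInf_le ⟨?_, ?_⟩
      · rintro _ ⟨u, rfl⟩
        exact ⟨_, hbV ⟨u, rfl⟩, rfl⟩
      · rintro _ ⟨x, hx, rfl⟩
        exact ⟨_, haV x hx, rfl⟩
    intro x _
    obtain ⟨y, hy, hyx⟩ := hle x.2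
    have hyx : y = x := Subtype.ext hyx
    exact hyx ▸ hy
  obtain ⟨χ, hχ, hdeg⟩ := exists_isStablePoly τ (Module.finrank ℝ R)
  obtain ⟨f₀, hf₀⟩ := hreach.exists_charpoly_eq hχ.1 hdeg
  obtain ⟨f, hf⟩ := LinearMap.exists_extend f₀
  have hf' : ∀ x : R, f x = f₀ x := fun x => LinearMap.congr_fun hf x
  refine ⟨f, ?_⟩
  have hinv : ∀ x ∈ R, (a + b ∘ₗ f : Module.End ℝ X) x ∈ R :=
    fun x hx => R.add_mem (haR x hx) (hbR _)
  have hle : R ≤ stableSubspace τ.stableRegion (a + b ∘ₗ f : Module.End ℝ X) := by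
    rw [← eigs_restrict_subset_iff hinv]
    have : (a + b ∘ₗ f : Module.End ℝ X).restrict hinv
        = a.restrict haR + b.codRestrict R hbR ∘ₗ f₀ := by
      ext x
      simp [hf']
    rw [this, eigs, hf₀]
    exact fun z hz => hχ.2 z (aeval_eq_zero_of_mem_rootSet hz)
  rintro _ ⟨u, rfl⟩
  exact hle (hbR u)

end PolePlacement

/-! ### Output nulling and input containing subspaces, pointwise -/

/-- A linear relation that is total on a subspace contains the graph of a linear map. -/
theorem exists_linearMap_mem {X U : Type*} [AddCommGroup X] [Module ℝ X] [AddCommGroup U]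
    [Module ℝ U] {M : Submodule ℝ (X × U)} {V : Submodule ℝ X}
    (h : ∀ x ∈ V, ∃ u, (x, u) ∈ M) : ∃ f : X →ₗ[ℝ] U, ∀ x ∈ V, (x, f x) ∈ M := by
  set M' : Submodule ℝ (X × U) := M ⊓ V.comap (LinearMap.fst ℝ X U) with hM'
  have hmem : ∀ y : M', (LinearMap.fst ℝ X U ∘ₗ M'.subtype) y ∈ V := fun y => y.2.2
  obtain ⟨s, hs⟩ := LinearMap.exists_rightInverse_of_surjective
    ((LinearMap.fst ℝ X U ∘ₗ M'.subtype).codRestrict V hmem) (by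
      rw [LinearMap.range_eq_top]
      rintro ⟨x, hx⟩
      obtain ⟨u, hu⟩ := h x hx
      exact ⟨⟨(x, u), hu, hx⟩, rfl⟩)
  obtain ⟨f, hf⟩ := LinearMap.exists_extend (LinearMap.snd ℝ X U ∘ₗ M'.subtype ∘ₗ s)
  refine ⟨f, fun x hx => ?_⟩
  have h1 : ((s ⟨x, hx⟩ : X × U)).1 = x :=
    congrArg Subtype.val (LinearMap.congr_fun hs ⟨x, hx⟩)
  have h2 : f x = (s ⟨x, hx⟩ : X × U).2 := LinearMap.congr_fun hf ⟨x, hx⟩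
  have h3 : (x, f x) = (s ⟨x, hx⟩ : X × U) := Prod.ext h1.symm h2
  rw [h3]
  exact (s ⟨x, hx⟩).2.1

section Quadruple

open Matrix

variable {ι μ π : Type*} [Fintype ι] [Fintype μ]
  {A : Matrix ι ι ℝ} {B : Matrix ι μ ℝ} {C : Matrix π ι ℝ} {D : Matrix π μ ℝ}
  {V S L : Submodule ℝ (ι → ℝ)} {F : Matrix μ ι ℝ}

theorem mem_prod_bot_sup_range {κ : Type*} {M : Matrix κ μ ℝ} {W : Submodule ℝ (κ → ℝ)}
    {x : κ → ℝ} {z : π → ℝ} :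
    (x, z) ∈ W.prod (⊥ : Submodule ℝ (π → ℝ)) ⊔ LinearMap.range (M.mulVecLin.prod D.mulVecLin) ↔
      ∃ u, x + M *ᵥ u ∈ W ∧ z + D *ᵥ u = 0 := by
  rw [Submodule.mem_sup]
  constructor
  · rintro ⟨⟨v, z'⟩, ⟨hv, hz⟩, _, ⟨u, rfl⟩, h⟩
    have hz : z' = 0 := hz
    subst hz
    have h1 : v + M *ᵥ u = x := congrArg Prod.fst h
    have h2 : 0 + D *ᵥ u = z := congrArg Prod.snd h
    refine ⟨-u, ?_, ?_⟩
    · rw [← h1, mulVec_neg, add_neg_cancel_right]; exact hv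
    · rw [← h2, mulVec_neg, zero_add, add_neg_cancel]
  · rintro ⟨u, h1, h2⟩
    refine ⟨(x + M *ᵥ u, 0), ⟨h1, rfl⟩, _, ⟨-u, rfl⟩, Prod.ext ?_ ?_⟩
    · simp [mulVec_neg]
    · simp only [LinearMap.prod_apply, Prod.snd_add]
      simp [mulVec_neg, neg_eq_of_add_eq_zero_left h2]

theorem isOutputNulling_iff : IsOutputNulling A B C D V ↔
    ∀ x ∈ V, ∃ u, A *ᵥ x + B *ᵥ u ∈ V ∧ C *ᵥ x + D *ᵥ u = 0 := by
  rw [IsOutputNulling, Submodule.map_le_iff_le_comap]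
  exact forall₂_congr fun x _ => mem_prod_bot_sup_range

theorem isOutputNullingFriend_iff : IsOutputNullingFriend A B C D V F ↔
    ∀ x ∈ V, A *ᵥ x + B *ᵥ (F *ᵥ x) ∈ V ∧ C *ᵥ x + D *ᵥ (F *ᵥ x) = 0 := by
  rw [IsOutputNullingFriend, Submodule.map_le_iff_le_comap]
  refine forall₂_congr fun x _ => ?_
  simp [Submodule.mem_prod, mulVec_mulVec]

theorem isInputContaining_iff : IsInputContaining A B C D S ↔
    ∀ x ∈ S, ∀ u, C *ᵥ x + D *ᵥ u = 0 → A *ᵥ x + B *ᵥ u ∈ S := by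
  rw [IsInputContaining, Submodule.map_le_iff_le_comap]
  constructor
  · intro h x hx u hu
    exact h (show (x, u) ∈ _ from ⟨⟨hx, trivial⟩, hu⟩)
  · rintro h ⟨x, u⟩ ⟨⟨hx, -⟩, hu⟩
    exact h x hx u hu

theorem isInputContainingFriend_iff [Fintype π] {G : Matrix ι π ℝ} :
    IsInputContainingFriend A B C D S G ↔
      (∀ x ∈ S, A *ᵥ x + G *ᵥ (C *ᵥ x) ∈ S) ∧ ∀ u, B *ᵥ u + G *ᵥ (D *ᵥ u) ∈ S := by
  rw [IsInputContainingFriend, Submodule.map_le_iff_le_comap]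
  constructor
  · refine fun h => ⟨fun x hx => ?_, fun u => ?_⟩
    · simpa [add_mulVec, mulVec_mulVec] using h (show (x, 0) ∈ _ from ⟨hx, trivial⟩)
    · simpa [add_mulVec, mulVec_mulVec] using
        h (show ((0 : ι → ℝ), u) ∈ _ from ⟨S.zero_mem, trivial⟩)
  · rintro ⟨h1, h2⟩ ⟨x, u⟩ ⟨hx, -⟩
    simpa [add_mulVec, mulVec_mulVec] using S.add_mem (h1 x hx) (h2 u)

theorem IsOutputNulling.exists_friend (h : IsOutputNulling A B C D V) :
    ∃ F, IsOutputNullingFriend A B C D V F := by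
  classical
  rw [isOutputNulling_iff] at h
  obtain ⟨f, hf⟩ := exists_linearMap_mem
    (M := V.comap (A.mulVecLin.coprod B.mulVecLin) ⊓
      LinearMap.ker (C.mulVecLin.coprod D.mulVecLin)) (V := V) h
  refine ⟨LinearMap.toMatrix' f, isOutputNullingFriend_iff.2 fun x hx => ?_⟩
  rw [LinearMap.toMatrix'_mulVec]
  exact hf x hx

theorem IsOutputNullingFriend.isOutputNulling (h : IsOutputNullingFriend A B C D V F) :
    IsOutputNulling A B C D V :=
  isOutputNulling_iff.2 fun x hx => ⟨F *ᵥ x, isOutputNullingFriend_iff.1 h x hx⟩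

theorem IsInputContaining.exists_friend [Fintype π] (h : IsInputContaining A B C D S) :
    ∃ G, IsInputContainingFriend A B C D S G := by
  classical
  rw [isInputContaining_iff] at h
  -- The relation between an output `C x + D u` with `x ∈ S` and the corrections of `A x + B u`
  -- that lead back into `S`.
  set M : Submodule ℝ ((π → ℝ) × (ι → ℝ)) :=
    ((S.prod (⊤ : Submodule ℝ (μ → ℝ))).prod S).map
      (((C.mulVecLin.coprod D.mulVecLin) ∘ₗ LinearMap.fst ℝ _ _).prod
        (LinearMap.snd ℝ _ _ - (A.mulVecLin.coprod B.mulVecLin) ∘ₗ LinearMap.fst ℝ _ _))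
    with hM
  obtain ⟨f, hf⟩ := exists_linearMap_mem (M := M)
    (V := (S.prod (⊤ : Submodule ℝ (μ → ℝ))).map (C.mulVecLin.coprod D.mulVecLin)) (by
      rintro _ ⟨xu, hxu, rfl⟩
      exact ⟨_, (xu, 0), ⟨hxu, S.zero_mem⟩, rfl⟩)
  have key : ∀ x ∈ S, ∀ u, A *ᵥ x + B *ᵥ u + f (C *ᵥ x + D *ᵥ u) ∈ S := by
    intro x hx u
    obtain ⟨⟨⟨x', u'⟩, s⟩, ⟨⟨hx', -⟩, hs⟩, he⟩ :=
      hf (C *ᵥ x + D *ᵥ u) ⟨(x, u), ⟨hx, trivial⟩, rfl⟩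
    have h1 : C *ᵥ x' + D *ᵥ u' = C *ᵥ x + D *ᵥ u := congrArg Prod.fst he
    have h2 : s - (A *ᵥ x' + B *ᵥ u') = f (C *ᵥ x + D *ᵥ u) := congrArg Prod.snd he
    have h3 := h (x - x') (S.sub_mem hx hx') (u - u') (by
      rw [mulVec_sub, mulVec_sub, sub_add_sub_comm, h1, sub_self])
    rw [← h2]
    convert S.add_mem h3 hs using 1
    rw [mulVec_sub, mulVec_sub]
    abel
  refine ⟨LinearMap.toMatrix' f, isInputContainingFriend_iff.2 ⟨fun x hx => ?_, fun u => ?_⟩⟩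
  · rw [LinearMap.toMatrix'_mulVec]
    simpa using key x hx 0
  · rw [LinearMap.toMatrix'_mulVec]
    simpa using key 0 S.zero_mem u

theorem IsInputContainingFriend.isInputContaining [Fintype π] {G : Matrix ι π ℝ}
    (h : IsInputContainingFriend A B C D S G) : IsInputContaining A B C D S := by
  rw [isInputContainingFriend_iff] at h
  refine isInputContaining_iff.2 fun x hx u hu => ?_
  have h3 : G *ᵥ (C *ᵥ x) + G *ᵥ (D *ᵥ u) = 0 := by rw [← mulVec_add, hu, mulVec_zero]
  have h4 := S.add_mem (h.1 x hx) (h.2 u)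
  rwa [add_add_add_comm, h3, add_zero] at h4

theorem le_Vstar (h : IsOutputNulling A B C D V) : V ≤ Vstar A B C D := le_sSup h

theorem Sstar_le (h : IsInputContaining A B C D S) : Sstar A B C D ≤ S := sInf_le h

theorem isOutputNulling_Vstar : IsOutputNulling A B C D (Vstar A B C D) :=
  (isGreatest_Vstar A B C D).1

theorem isInputContaining_Sstar : IsInputContaining A B C D (Sstar A B C D) :=
  (isLeast_Sstar A B C D).1

/-- A state that can be steered into `V⋆` with zero output lies in `V⋆`. -/
theorem mem_Vstar_of_step {x : ι → ℝ} {u : μ → ℝ} (h : A *ᵥ x + B *ᵥ u ∈ Vstar A B C D)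
    (h0 : C *ᵥ x + D *ᵥ u = 0) : x ∈ Vstar A B C D := by
  have hON : IsOutputNulling A B C D (Vstar A B C D ⊔ Submodule.span ℝ {x}) := by
    have hV := isOutputNulling_iff.1 (isOutputNulling_Vstar (A := A) (B := B) (C := C) (D := D))
    refine isOutputNulling_iff.2 fun y hy => ?_
    obtain ⟨v, hv, s, hs, rfl⟩ := Submodule.mem_sup.1 hy
    obtain ⟨c, rfl⟩ := Submodule.mem_span_singleton.1 hs
    obtain ⟨u₁, h₁, h₂⟩ := hV v hv
    refine ⟨u₁ + c • u, ?_, ?_⟩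
    · rw [mulVec_add, mulVec_add, mulVec_smul, mulVec_smul, add_add_add_comm, ← smul_add]
      exact Submodule.mem_sup_left (Submodule.add_mem _ h₁ (Submodule.smul_mem _ _ h))
    · rw [mulVec_add, mulVec_add, mulVec_smul, mulVec_smul, add_add_add_comm, ← smul_add, h₂, h0,
        smul_zero, add_zero]
  exact le_Vstar hON (Submodule.mem_sup_right (Submodule.mem_span_singleton_self x))

/-! ### The largest reachability output nulling subspace is `V⋆ ⊓ S⋆` -/

/-- Friends of `V⋆` are friends of `V⋆ ⊓ S⋆`. -/
theorem IsOutputNullingFriend.inf_Sstar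
    (hF : IsOutputNullingFriend A B C D (Vstar A B C D) F) :
    IsOutputNullingFriend A B C D (Vstar A B C D ⊓ Sstar A B C D) F := by
  rw [isOutputNullingFriend_iff] at hF ⊢
  intro x hx
  have h1 := hF x hx.1
  exact ⟨⟨h1.1, isInputContaining_iff.1 isInputContaining_Sstar x hx.2 _ h1.2⟩, h1.2⟩

/-- The subspace `V⋆ ⊓ S⋆` is reachable: it is the smallest subspace that is invariant under a
friend of `V⋆` and contains the directions of `V⋆` that the input reaches with zero output. The
subspace `S⋆` is the union of the increasing chain `S₀ = 0`, `Sₖ₊₁ = [A B] ((Sₖ ⊕ U) ⊓ ker [C D])`,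
and each `V⋆ ⊓ Sₖ` is controlled by induction. -/
theorem Vstar_inf_Sstar_le (hF : IsOutputNullingFriend A B C D (Vstar A B C D) F)
    (hinv : ∀ x ∈ L, A *ᵥ x + B *ᵥ (F *ᵥ x) ∈ L)
    (hL : ∀ u, B *ᵥ u ∈ Vstar A B C D → D *ᵥ u = 0 → B *ᵥ u ∈ L) :
    Vstar A B C D ⊓ Sstar A B C D ≤ L := by
  rw [isOutputNullingFriend_iff] at hF
  let Φ : Submodule ℝ (ι → ℝ) → Submodule ℝ (ι → ℝ) := fun S =>
    (S.prod (⊤ : Submodule ℝ (μ → ℝ)) ⊓ LinearMap.ker (C.mulVecLin.coprod D.mulVecLin)).map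
      (A.mulVecLin.coprod B.mulVecLin)
  have hΦ : Monotone Φ := fun S T h =>
    Submodule.map_mono (inf_le_inf_right _ (Submodule.prod_mono h le_rfl))
  have hmono : Monotone fun k : ℕ => Φ^[k] ⊥ := hΦ.monotone_iterate_of_le_map bot_le
  have hstep : ∀ k, Vstar A B C D ⊓ Φ^[k] ⊥ ≤ L := by
    intro k
    induction k with
    | zero => simp
    | succ k ih =>
      rintro x ⟨hxV, hxS⟩
      rw [Function.iterate_succ_apply'] at hxS
      obtain ⟨⟨s, u⟩, ⟨⟨hs, -⟩, h0⟩, hx⟩ := hxS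
      have h0 : C *ᵥ s + D *ᵥ u = 0 := h0
      have hx : A *ᵥ s + B *ᵥ u = x := hx
      have hsV : s ∈ Vstar A B C D := mem_Vstar_of_step (by rw [hx]; exact hxV) h0
      have hsF := hF s hsV
      have hsub : B *ᵥ (u - F *ᵥ s) = x - (A *ᵥ s + B *ᵥ (F *ᵥ s)) := by
        rw [← hx, mulVec_sub]; abel
      have hBL := hL (u - F *ᵥ s) (by rw [hsub]; exact Submodule.sub_mem _ hxV hsF.1) (by
        rw [mulVec_sub, ← add_sub_add_left_eq_sub _ _ (C *ᵥ s), h0, hsF.2, sub_zero])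
      have := L.add_mem hBL (hinv s (ih ⟨hsV, hs⟩))
      rwa [hsub, sub_add_cancel] at this
  have hIC : IsInputContaining A B C D (⨆ k : ℕ, Φ^[k] ⊥) := by
    refine isInputContaining_iff.2 fun x hx u hu => ?_
    obtain ⟨k, hk⟩ := (Submodule.mem_iSup_of_directed _ hmono.directed_le).1 hx
    refine Submodule.mem_iSup_of_mem (k + 1) ?_
    rw [Function.iterate_succ_apply']
    exact ⟨(x, u), ⟨⟨hk, trivial⟩, hu⟩, rfl⟩
  rintro x ⟨hxV, hxS⟩
  obtain ⟨k, hk⟩ := (Submodule.mem_iSup_of_directed _ hmono.directed_le).1 (Sstar_le hIC hxS)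
  exact hstep k ⟨hxV, hk⟩

/-- Poles can be placed on `V⋆ ⊓ S⋆` by friends of `V⋆`. -/
theorem exists_friend_charpoly_eq {P : ℝ[X]} (hP : P.Monic)
    (hdeg : P.natDegree = Module.finrank ℝ ↥(Vstar A B C D ⊓ Sstar A B C D)) :
    ∃ F, IsOutputNullingFriend A B C D (Vstar A B C D) F ∧
      ∃ h : IsOutputNullingFriend A B C D (Vstar A B C D ⊓ Sstar A B C D) F,
        h.restrict.charpoly = P := by
  classical
  obtain ⟨F, hF⟩ := (isOutputNulling_Vstar (A := A) (B := B) (C := C) (D := D)).exists_friend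
  have hFR := hF.inf_Sstar
  set R := Vstar A B C D ⊓ Sstar A B C D with hR
  let UR : Submodule ℝ (μ → ℝ) := R.comap B.mulVecLin ⊓ LinearMap.ker D.mulVecLin
  let b : UR →ₗ[ℝ] R := (B.mulVecLin ∘ₗ UR.subtype).codRestrict R fun u => u.2.1
  have hreach : IsReachablePair hFR.restrict b := by
    intro W hbW haW
    rw [eq_top_iff]
    have hle : R ≤ W.map R.subtype := by
      refine Vstar_inf_Sstar_le hF ?_ fun u hu hu0 => ?_
      · rintro _ ⟨x, hx, rfl⟩
        refine ⟨_, haW x hx, ?_⟩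
        change (A + B * F) *ᵥ (x : ι → ℝ) = _
        rw [add_mulVec, mulVec_mulVec]
        rfl
      · have huS : B *ᵥ u ∈ Sstar A B C D := by
          simpa using isInputContaining_iff.1 isInputContaining_Sstar 0
            (Submodule.zero_mem _) u (by simpa using hu0)
        exact ⟨_, hbW ⟨⟨u, ⟨hu, huS⟩, hu0⟩, rfl⟩, rfl⟩
    intro x _
    obtain ⟨y, hy, hyx⟩ := hle x.2
    have hyx : y = x := Subtype.ext hyx
    exact hyx ▸ hy
  obtain ⟨f₀, hf₀⟩ := hreach.exists_charpoly_eq hP hdeg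
  obtain ⟨f, hf⟩ := LinearMap.exists_extend f₀
  have hf' : ∀ x : R, f x = f₀ x := fun x => LinearMap.congr_fun hf x
  have hmulVec : ∀ x, (F + LinearMap.toMatrix' (UR.subtype ∘ₗ f)) *ᵥ x = F *ᵥ x + f x := by
    intro x
    rw [add_mulVec, LinearMap.toMatrix'_mulVec]
    rfl
  have hF' : IsOutputNullingFriend A B C D (Vstar A B C D)
      (F + LinearMap.toMatrix' (UR.subtype ∘ₗ f)) := by
    rw [isOutputNullingFriend_iff] at hF ⊢
    intro x hx
    have h1 : B *ᵥ (f x : μ → ℝ) ∈ R := (f x).2.1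
    have h2 : D *ᵥ (f x : μ → ℝ) = 0 := (f x).2.2
    rw [hmulVec, mulVec_add, mulVec_add, h2, add_zero, ← add_assoc]
    exact ⟨Submodule.add_mem _ (hF x hx).1 h1.1, (hF x hx).2⟩
  refine ⟨_, hF', hF'.inf_Sstar, ?_⟩
  rw [← hf₀]
  congr 1
  ext1 x
  refine Subtype.ext ?_
  change (A + B * _) *ᵥ (x : ι → ℝ) = (A + B * F) *ᵥ (x : ι → ℝ) + B *ᵥ (f₀ x : μ → ℝ)
  rw [add_mulVec, ← mulVec_mulVec, hmulVec, mulVec_add, add_mulVec, mulVec_mulVec, add_assoc, hf']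

/-- An assignable output nulling subspace is contained in `S⋆`: modulo `S⋆` all of its friends act
in the same way, so that the characteristic polynomials `X ^ d` and `(X - 1) ^ d` cannot both occur
on a non-zero quotient. -/
theorem IsReachabilityOutputNulling.le_Sstar (h : IsReachabilityOutputNulling A B C D V) :
    V ≤ Sstar A B C D := by
  set d := Module.finrank ℝ V
  obtain ⟨F₀, h₀, hP₀⟩ := h.2 (X ^ d) (monic_X_pow d) (by simp [d])
  obtain ⟨F₁, h₁, hP₁⟩ := h.2 ((X - Polynomial.C 1) ^ d) ((monic_X_sub_C 1).pow d)
    (by rw [natDegree_pow, natDegree_X_sub_C, mul_one])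
  have hf₀ := h₀.restrict.aeval_self_charpoly
  have hf₁ := h₁.restrict.aeval_self_charpoly
  rw [hP₀] at hf₀
  rw [hP₁] at hf₁
  have hIC := isInputContaining_iff.1 (isInputContaining_Sstar (A := A) (B := B) (C := C) (D := D))
  have e₀ := isOutputNullingFriend_iff.1 h₀
  have e₁ := isOutputNullingFriend_iff.1 h₁
  have hLinv : ∀ y ∈ (Sstar A B C D).comap V.subtype,
      h₁.restrict y ∈ (Sstar A B C D).comap V.subtype := by
    intro y hy
    change (A + B * F₁) *ᵥ (y : ι → ℝ) ∈ Sstar A B C D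
    rw [add_mulVec, ← mulVec_mulVec]
    exact hIC y hy _ (e₁ y y.2).2
  have hdiff : ∀ x : V, (LinearMap.id : V →ₗ[ℝ] V) (h₀.restrict x) -
      h₁.restrict ((LinearMap.id : V →ₗ[ℝ] V) x) ∈ (Sstar A B C D).comap V.subtype := by
    intro x
    change (A + B * F₀) *ᵥ (x : ι → ℝ) - (A + B * F₁) *ᵥ (x : ι → ℝ) ∈ Sstar A B C D
    have := hIC 0 (Submodule.zero_mem _) (F₀ *ᵥ x - F₁ *ᵥ x) (by
      rw [mulVec_zero, zero_add, mulVec_sub, ← add_sub_add_left_eq_sub _ _ (C *ᵥ (x : ι → ℝ)),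
        (e₀ x x.2).2, (e₁ x x.2).2, sub_zero])
    convert this using 1
    simp only [add_mulVec, ← mulVec_mulVec, mulVec_sub, mulVec_zero]
    abel
  have hcop : IsCoprime (X ^ d : ℝ[X]) ((X - Polynomial.C 1) ^ d) := by
    refine IsCoprime.pow ?_
    have := isCoprime_X_sub_C_of_isUnit_sub (a := (0 : ℝ)) (b := 1) (by simp)
    simpa using this
  obtain ⟨p, q, hpq⟩ := hcop
  intro x hx
  have h1 := intertwine_aeval hLinv hdiff (X ^ d) ⟨x, hx⟩
  rw [hf₀, LinearMap.zero_apply, map_zero, zero_sub, neg_mem_iff] at h1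
  have h2 := aeval_mem_of_invariant hLinv p h1
  have h3 : aeval h₁.restrict p (aeval h₁.restrict (X ^ d : ℝ[X]) ⟨x, hx⟩) = ⟨x, hx⟩ := by
    have := congrArg (aeval h₁.restrict) hpq
    rw [map_add, map_mul, map_mul, hf₁, mul_zero, add_zero, map_one] at this
    exact LinearMap.congr_fun this ⟨x, hx⟩
  rw [LinearMap.id_apply, h3] at h2
  exact h2

theorem Rstar_eq : Rstar A B C D = Vstar A B C D ⊓ Sstar A B C D := by
  refine le_antisymm (sSup_le fun V hV => le_inf (le_Vstar hV.1) hV.le_Sstar)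
    (le_sSup ⟨?_, fun P hP hdeg => ?_⟩)
  · obtain ⟨F, hF⟩ := (isOutputNulling_Vstar (A := A) (B := B) (C := C) (D := D)).exists_friend
    exact hF.inf_Sstar.isOutputNulling
  · obtain ⟨F, -, h⟩ := exists_friend_charpoly_eq hP hdeg
    exact ⟨F, h⟩

/-! ### Internal stabilizability -/

theorem IsOutputNullingFriend.eigs_restrict_subset_iff {Ω : Set ℂ}
    (h : IsOutputNullingFriend A B C D V F) :
    eigs h.restrict ⊆ Ω ↔ V ≤ stableSubspace Ω (A + B * F).mulVecLin :=
  GeometricControl.eigs_restrict_subset_iff h.invariant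

/-- Some friend of `V⋆` is stable on `V⋆ ⊓ S⋆`. -/
theorem exists_friend_stable (τ : TimeDomain) (A : Matrix ι ι ℝ) (B : Matrix ι μ ℝ)
    (C : Matrix π ι ℝ) (D : Matrix π μ ℝ) :
    ∃ F, IsOutputNullingFriend A B C D (Vstar A B C D) F ∧ Vstar A B C D ⊓ Sstar A B C D ≤
      stableSubspace τ.stableRegion (A + B * F).mulVecLin := by
  obtain ⟨χ, hχ, hdeg⟩ := exists_isStablePoly τ
    (Module.finrank ℝ ↥(Vstar A B C D ⊓ Sstar A B C D))
  obtain ⟨F, hF, h, hFχ⟩ := exists_friend_charpoly_eq (A := A) (B := B) (C := C) (D := D) hχ.1 hdeg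
  refine ⟨F, hF, h.eigs_restrict_subset_iff.1 ?_⟩
  rw [eigs, hFχ]
  exact fun z hz => hχ.2 z (aeval_eq_zero_of_mem_rootSet hz)

/-- Friends of `V⋆` are friends of every output nulling subspace that contains `V⋆ ⊓ S⋆`
(self-boundedness). -/
theorem IsOutputNullingFriend.of_le (hF : IsOutputNullingFriend A B C D (Vstar A B C D) F)
    (hV : IsOutputNulling A B C D V) (hR : Vstar A B C D ⊓ Sstar A B C D ≤ V) :
    IsOutputNullingFriend A B C D V F := by
  have hVs := le_Vstar hV
  rw [isOutputNullingFriend_iff] at hF ⊢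
  intro x hx
  have h1 := hF x (hVs hx)
  obtain ⟨u, h2, h3⟩ := isOutputNulling_iff.1 hV x hx
  refine ⟨?_, h1.2⟩
  have he : B *ᵥ (F *ᵥ x - u) = A *ᵥ x + B *ᵥ (F *ᵥ x) - (A *ᵥ x + B *ᵥ u) := by
    rw [mulVec_sub]; abel
  have hD : D *ᵥ (F *ᵥ x - u) = 0 := by
    rw [mulVec_sub, ← add_sub_add_left_eq_sub _ _ (C *ᵥ x), h1.2, h3, sub_zero]
  have hmem : B *ᵥ (F *ᵥ x - u) ∈ V := by
    refine hR ⟨?_, ?_⟩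
    · rw [he]; exact Submodule.sub_mem _ h1.1 (hVs h2)
    · simpa using isInputContaining_iff.1 (isInputContaining_Sstar (A := A) (B := B) (C := C)
        (D := D)) 0 (Submodule.zero_mem _) (F *ᵥ x - u) (by simpa using hD)
  rw [he] at hmem
  have h4 := V.add_mem hmem h2
  rwa [sub_add_cancel] at h4

/-- Over a stabilizable pair, a stabilizing friend of an internally stabilizable subspace can be
chosen to stabilize the whole state space: it is corrected by a feedback of the state modulo
`V`. -/
theorem IsInternallyStabilizable.exists_stable_friend {τ : TimeDomain} (hAB : IsStabilizable τ A B)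
    (h : IsInternallyStabilizable τ A B C D V) :
    ∃ F, IsOutputNullingFriend A B C D V F ∧
      stableSubspace τ.stableRegion (A + B * F).mulVecLin = ⊤ := by
  classical
  obtain ⟨F₁, h₁, hs₁⟩ := h
  obtain ⟨F₂, hs₂⟩ := hAB
  rw [eigs_subset_iff] at hs₁ hs₂
  have e₁ := isOutputNullingFriend_iff.1 h₁
  set a : Module.End ℝ ((ι → ℝ) ⧸ V) := V.mapQ V (A + B * F₁).mulVecLin h₁.invariant with ha
  set b : (μ → ℝ) →ₗ[ℝ] (ι → ℝ) ⧸ V := V.mkQ ∘ₗ B.mulVecLin with hb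
  obtain ⟨f, hf⟩ := exists_feedback_range_le_stableSubspace τ a b
  set F := F₁ + LinearMap.toMatrix' (f ∘ₗ V.mkQ) with hFdef
  have hF : ∀ x, F *ᵥ x = F₁ *ᵥ x + f (V.mkQ x) := by
    intro x
    rw [hFdef, add_mulVec, LinearMap.toMatrix'_mulVec]
    rfl
  have hFV : ∀ x ∈ V, F *ᵥ x = F₁ *ᵥ x := by
    intro x hx
    rw [hF, Submodule.mkQ_apply, (Submodule.Quotient.mk_eq_zero V).2 hx, map_zero, add_zero]
  have hstepF : ∀ x, (A + B * F).mulVecLin x = A *ᵥ x + B *ᵥ (F *ᵥ x) := fun x => by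
    simp [mulVec_mulVec]
  have hstep₁ : ∀ x, (A + B * F₁).mulVecLin x = A *ᵥ x + B *ᵥ (F₁ *ᵥ x) := fun x => by
    simp [mulVec_mulVec]
  have hstep₂ : ∀ x, (A + B * F₂).mulVecLin x = A *ᵥ x + B *ᵥ (F₂ *ᵥ x) := fun x => by
    simp [mulVec_mulVec]
  have hfr : IsOutputNullingFriend A B C D V F := by
    refine isOutputNullingFriend_iff.2 fun x hx => ?_
    rw [hFV x hx]
    exact e₁ x hx
  refine ⟨F, hfr, ?_⟩
  have hV : V ≤ stableSubspace τ.stableRegion (A + B * F).mulVecLin := by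
    intro x hx
    refine map_mem_stableSubspace (f := h₁.restrict) (φ := V.subtype) (fun y => ?_)
      (x := ⟨x, hx⟩) (hs₁ ▸ Submodule.mem_top)
    have : V.subtype (h₁.restrict y) = (A + B * F).mulVecLin (V.subtype y) := by
      change (A + B * F₁).mulVecLin y = (A + B * F).mulVecLin y
      rw [hstepF, hstep₁, hFV y y.2]
    rw [this, sub_self]
    exact Submodule.zero_mem _
  have hcomm : ∀ x, V.mkQ ((A + B * F).mulVecLin x) = (a + b ∘ₗ f) (V.mkQ x) := by
    intro x
    rw [hstepF, hF, mulVec_add, ← add_assoc, map_add, ← hstep₁]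
    rfl
  rw [eq_top_iff]
  intro x _
  have hq : V.mkQ x ∈ stableSubspace τ.stableRegion (a + b ∘ₗ f) := by
    refine map_mem_stableSubspace (f := (A + B * F₂).mulVecLin) (fun y => hf ?_)
      (hs₂ ▸ Submodule.mem_top)
    refine ⟨F₂ *ᵥ y - F *ᵥ y, ?_⟩
    rw [← hcomm, hstepF, hstep₂, ← map_sub, add_sub_add_left_eq_sub, ← mulVec_sub]
    rfl
  obtain ⟨χ, hχ, h0⟩ := hq
  have h1 := intertwine_aeval (f := (A + B * F).mulVecLin) (g := a + b ∘ₗ f) (φ := V.mkQ)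
    (L := ⊥) (by simp) (fun y => by rw [hcomm, sub_self]; exact Submodule.zero_mem _) χ x
  rw [h0, sub_zero, Submodule.mem_bot, Submodule.mkQ_apply, Submodule.Quotient.mk_eq_zero] at h1
  exact mem_stableSubspace_of_aeval_mem hχ (hV h1)

end Quadruple

/-! ### Duality -/

section Duality

open Matrix

section Perp

variable {ι : Type*} [Fintype ι]

/-- The orthogonal complement of a subspace with respect to the dot product. -/
def perp (S : Submodule ℝ (ι → ℝ)) : Submodule ℝ (ι → ℝ) where
  carrier := {x | ∀ s ∈ S, x ⬝ᵥ s = 0}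
  add_mem' := fun hx hy s hs => by rw [add_dotProduct, hx s hs, hy s hs, add_zero]
  zero_mem' := fun s _ => zero_dotProduct s
  smul_mem' := fun c x hx s hs => by rw [smul_dotProduct, hx s hs, smul_zero]

theorem exists_dotProduct_eq (φ : (ι → ℝ) →ₗ[ℝ] ℝ) : ∃ x : ι → ℝ, ∀ y, x ⬝ᵥ y = φ y := by
  classical
  refine ⟨(dotProductEquiv ℝ ι).symm φ, fun y => ?_⟩
  exact LinearMap.congr_fun ((dotProductEquiv ℝ ι).apply_symm_apply φ) y

theorem perp_perp (S : Submodule ℝ (ι → ℝ)) : perp (perp S) = S := by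
  refine le_antisymm (fun x hx => ?_) fun x hx y hy => by rw [dotProduct_comm, hy x hx]
  by_contra hxS
  obtain ⟨φ, hφx, hφS⟩ := S.exists_le_ker_of_notMem hxS
  obtain ⟨y, hy⟩ := exists_dotProduct_eq φ
  have hyS : y ∈ perp S := fun s hs => by rw [hy]; exact hφS hs
  exact hφx (by rw [← hy, dotProduct_comm, hx y hyS])

/-- Taking orthogonal complements reverses the order of subspaces. -/
def perpIso : Submodule ℝ (ι → ℝ) ≃o (Submodule ℝ (ι → ℝ))ᵒᵈ where
  toFun S := OrderDual.toDual (perp S)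
  invFun S := perp (OrderDual.ofDual S)
  left_inv S := perp_perp S
  right_inv S := perp_perp (OrderDual.ofDual S)
  map_rel_iff' {S T} := by
    constructor
    · intro h
      rw [← perp_perp S, ← perp_perp T]
      exact fun x hx y hy => hx y (h hy)
    · exact fun h x hx y hy => hx y (h hy)

theorem perp_sInf (s : Set (Submodule ℝ (ι → ℝ))) : perp (sInf s) = sSup (perp '' s) := by
  have h := (perpIso (ι := ι)).map_sInf s
  rw [sSup_image]
  exact h

theorem perp_sup (S T : Submodule ℝ (ι → ℝ)) : perp (S ⊔ T) = perp S ⊓ perp T :=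
  (perpIso (ι := ι)).map_sup S T

theorem perp_injective : Function.Injective (perp : Submodule ℝ (ι → ℝ) → _) :=
  fun S T h => by rw [← perp_perp S, h, perp_perp]

theorem mulVec_transpose_dotProduct {κ : Type*} [Fintype κ] (M : Matrix ι κ ℝ) (x : ι → ℝ)
    (y : κ → ℝ) : Mᵀ *ᵥ x ⬝ᵥ y = x ⬝ᵥ M *ᵥ y := by
  rw [mulVec_transpose, dotProduct_mulVec]

end Perp

theorem charpoly_dualMap {M : Type*} [AddCommGroup M] [Module ℝ M] [Module.Finite ℝ M]
    (f : Module.End ℝ M) : LinearMap.charpoly f.dualMap = f.charpoly := by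
  classical
  rw [← LinearMap.charpoly_toMatrix f (Module.finBasis ℝ M),
    ← LinearMap.charpoly_toMatrix f.dualMap (Module.finBasis ℝ M).dualBasis,
    LinearMap.dualMap_def, LinearMap.toMatrix_transpose, Matrix.charpoly_transpose]

variable {ι μ π : Type*} [Fintype ι] [Fintype μ] [Fintype π]
  {A : Matrix ι ι ℝ} {B : Matrix ι μ ℝ} {C : Matrix π ι ℝ} {D : Matrix π μ ℝ}
  {S : Submodule ℝ (ι → ℝ)} {G : Matrix ι π ℝ}

theorem isInputContainingFriend_iff_dual : IsInputContainingFriend A B C D S G ↔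
    IsOutputNullingFriend Aᵀ Cᵀ Bᵀ Dᵀ (perp S) Gᵀ := by
  rw [isInputContainingFriend_iff, isOutputNullingFriend_iff]
  have e₁ : ∀ x y, (Aᵀ *ᵥ x + Cᵀ *ᵥ (Gᵀ *ᵥ x)) ⬝ᵥ y = x ⬝ᵥ (A *ᵥ y + G *ᵥ (C *ᵥ y)) := by
    intro x y
    simp only [add_dotProduct, dotProduct_add, mulVec_transpose_dotProduct]
  have e₂ : ∀ x u, (Bᵀ *ᵥ x + Dᵀ *ᵥ (Gᵀ *ᵥ x)) ⬝ᵥ u = x ⬝ᵥ (B *ᵥ u + G *ᵥ (D *ᵥ u)) := by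
    intro x y
    simp only [add_dotProduct, dotProduct_add, mulVec_transpose_dotProduct]
  constructor
  · rintro ⟨h1, h2⟩ x hx
    refine ⟨fun s hs => by rw [e₁, hx _ (h1 s hs)], ?_⟩
    exact dotProduct_eq_zero _ fun u => by rw [e₂, hx _ (h2 u)]
  · intro h
    rw [← perp_perp S]
    refine ⟨fun y hy x hx => ?_, fun u x hx => ?_⟩
    · rw [perp_perp] at hy
      rw [dotProduct_comm, ← e₁, (h x hx).1 y hy]
    · rw [dotProduct_comm, ← e₂, (h x hx).2, zero_dotProduct]

theorem isInputContaining_iff_dual : IsInputContaining A B C D S ↔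
    IsOutputNulling Aᵀ Cᵀ Bᵀ Dᵀ (perp S) := by
  constructor
  · intro h
    obtain ⟨G, hG⟩ := h.exists_friend
    exact (isInputContainingFriend_iff_dual.1 hG).isOutputNulling
  · intro h
    obtain ⟨F, hF⟩ := h.exists_friend
    refine (isInputContainingFriend_iff_dual (G := Fᵀ).2 ?_).isInputContaining
    rwa [transpose_transpose]

/-- The pairing of `perp S` with the quotient by `S` that is induced by the dot product. -/
noncomputable def perpToDualQuotient (S : Submodule ℝ (ι → ℝ)) :
    perp S →ₗ[ℝ] Module.Dual ℝ ((ι → ℝ) ⧸ S) where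
  toFun x := S.liftQ (dotProductBilin ℝ ℝ (x : ι → ℝ)) fun s hs => x.2 s hs
  map_add' x y := Submodule.linearMap_qext _ (LinearMap.ext fun v =>
    add_dotProduct (x : ι → ℝ) y v)
  map_smul' c x := Submodule.linearMap_qext _ (LinearMap.ext fun v =>
    smul_dotProduct c (x : ι → ℝ) v)

/-- The functionals on the quotient by `S` are the dot products with vectors of `perp S`. -/
theorem perpToDualQuotient_bijective (S : Submodule ℝ (ι → ℝ)) :
    Function.Bijective (perpToDualQuotient S) := by
  constructor
  · intro x y hxy
    refine Subtype.ext (dotProduct_eq _ _ fun v => ?_)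
    exact LinearMap.congr_fun hxy (S.mkQ v)
  · intro φ
    obtain ⟨x, hx⟩ := exists_dotProduct_eq (φ ∘ₗ S.mkQ)
    refine ⟨⟨x, fun s hs => ?_⟩, ?_⟩
    · rw [hx, LinearMap.comp_apply, Submodule.mkQ_apply, (Submodule.Quotient.mk_eq_zero S).2 hs,
        map_zero]
    · ext v
      exact hx v

/-- The subspace `perp S` as the dual space of the quotient by `S`. -/
noncomputable def perpEquivDualQuotient (S : Submodule ℝ (ι → ℝ)) :
    perp S ≃ₗ[ℝ] Module.Dual ℝ ((ι → ℝ) ⧸ S) :=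
  LinearEquiv.ofBijective (perpToDualQuotient S) (perpToDualQuotient_bijective S)

theorem perpEquivDualQuotient_apply {S : Submodule ℝ (ι → ℝ)} (x : perp S) (v : ι → ℝ) :
    perpEquivDualQuotient S x (S.mkQ v) = (x : ι → ℝ) ⬝ᵥ v := rfl

theorem charpoly_quotient_eq (h : IsInputContainingFriend A B C D S G)
    (h' : IsOutputNullingFriend Aᵀ Cᵀ Bᵀ Dᵀ (perp S) Gᵀ) :
    h.quotient.charpoly = h'.restrict.charpoly := by
  rw [← charpoly_dualMap, ← LinearEquiv.charpoly_conj (perpEquivDualQuotient S) h'.restrict]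
  congr 1
  ext φ v
  obtain ⟨x, rfl⟩ := (perpEquivDualQuotient S).surjective φ
  simp only [LinearEquiv.conj_apply, LinearMap.comp_apply, LinearEquiv.coe_coe,
    LinearEquiv.symm_apply_apply, LinearMap.dualMap_apply, perpEquivDualQuotient_apply]
  change (x : ι → ℝ) ⬝ᵥ (A + G * C) *ᵥ v = ((Aᵀ + Cᵀ * Gᵀ) *ᵥ (x : ι → ℝ)) ⬝ᵥ v
  rw [← transpose_mul, ← transpose_add, mulVec_transpose_dotProduct]

theorem isExternallyDetectable_iff_dual {τ : TimeDomain} : IsExternallyDetectable τ A B C D S ↔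
    IsInternallyStabilizable τ Aᵀ Cᵀ Bᵀ Dᵀ (perp S) := by
  constructor
  · rintro ⟨G, h, hs⟩
    refine ⟨Gᵀ, isInputContainingFriend_iff_dual.1 h, ?_⟩
    rwa [eigs, ← charpoly_quotient_eq h]
  · rintro ⟨F, h, hs⟩
    refine ⟨Fᵀ, isInputContainingFriend_iff_dual.2 (by rwa [transpose_transpose]), ?_⟩
    rw [eigs, charpoly_quotient_eq _ (by rwa [transpose_transpose])]
    simpa only [eigs, transpose_transpose] using hs

theorem isUnobservabilityInputContaining_iff_dual :
    IsUnobservabilityInputContaining A B C D S ↔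
      IsReachabilityOutputNulling Aᵀ Cᵀ Bᵀ Dᵀ (perp S) := by
  have hrank : Module.finrank ℝ ((ι → ℝ) ⧸ S) = Module.finrank ℝ (perp S) := by
    rw [(perpEquivDualQuotient S).finrank_eq, Subspace.dual_finrank_eq]
  rw [IsUnobservabilityInputContaining, IsReachabilityOutputNulling, isInputContaining_iff_dual,
    hrank]
  refine and_congr_right fun _ => forall₃_congr fun P _ _ => ⟨?_, ?_⟩
  · rintro ⟨G, h, hs⟩
    exact ⟨Gᵀ, isInputContainingFriend_iff_dual.1 h, by rw [← charpoly_quotient_eq h, hs]⟩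
  · rintro ⟨F, h, hs⟩
    refine ⟨Fᵀ, isInputContainingFriend_iff_dual.2 (by rwa [transpose_transpose]), ?_⟩
    rw [charpoly_quotient_eq _ (by rwa [transpose_transpose])]
    simpa only [eigs, transpose_transpose] using hs

theorem perp_Sstar : perp (Sstar A B C D) = Vstar Aᵀ Cᵀ Bᵀ Dᵀ := by
  rw [Sstar, Vstar, perp_sInf]
  congr 1
  ext V
  constructor
  · rintro ⟨S, hS, rfl⟩
    exact isInputContaining_iff_dual.1 hS
  · exact fun hV => ⟨perp V, isInputContaining_iff_dual.2 (by rwa [perp_perp]), perp_perp V⟩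

theorem perp_Vstar : perp (Vstar A B C D) = Sstar Aᵀ Cᵀ Bᵀ Dᵀ := by
  rw [← perp_perp (Sstar Aᵀ Cᵀ Bᵀ Dᵀ), perp_Sstar]
  simp only [transpose_transpose]

theorem perp_Qstar : perp (Qstar A B C D) = Rstar Aᵀ Cᵀ Bᵀ Dᵀ := by
  rw [Qstar, Rstar, perp_sInf]
  congr 1
  ext V
  constructor
  · rintro ⟨S, hS, rfl⟩
    exact isUnobservabilityInputContaining_iff_dual.1 hS
  · exact fun hV => ⟨perp V, isUnobservabilityInputContaining_iff_dual.2 (by rwa [perp_perp]),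
      perp_perp V⟩

theorem Qstar_eq : Qstar A B C D = Sstar A B C D ⊔ Vstar A B C D :=
  perp_injective (by rw [perp_Qstar, Rstar_eq, perp_sup, perp_Sstar, perp_Vstar])

theorem eigs_mulVecLin_transpose (M : Matrix ι ι ℝ) : eigs Mᵀ.mulVecLin = eigs M.mulVecLin := by
  classical
  rw [eigs, eigs, ← Matrix.toLin'_apply', ← Matrix.toLin'_apply', Matrix.charpoly_toLin',
    Matrix.charpoly_toLin', Matrix.charpoly_transpose]

theorem isDetectable_iff_dual {τ : TimeDomain} : IsDetectable τ C A ↔ IsStabilizable τ Aᵀ Cᵀ := by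
  have key : ∀ G : Matrix ι π ℝ,
      eigs (A + G * C).mulVecLin = eigs (Aᵀ + Cᵀ * Gᵀ).mulVecLin := fun G => by
    rw [← transpose_mul, ← transpose_add, eigs_mulVecLin_transpose]
  constructor
  · rintro ⟨G, hG⟩
    exact ⟨Gᵀ, key G ▸ hG⟩
  · rintro ⟨F, hF⟩
    refine ⟨Fᵀ, ?_⟩
    rwa [key, transpose_transpose]

/-- Over a detectable pair, an externally detectable subspace has a friend that makes the whole
state space stable. -/
theorem IsExternallyDetectable.exists_stable_friend {τ : TimeDomain} (hCA : IsDetectable τ C A)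
    (h : IsExternallyDetectable τ A B C D S) :
    ∃ G, IsInputContainingFriend A B C D S G ∧
      stableSubspace τ.stableRegion (A + G * C).mulVecLin = ⊤ := by
  obtain ⟨F, hF, hs⟩ := (isExternallyDetectable_iff_dual.1 h).exists_stable_friend
    (isDetectable_iff_dual.1 hCA)
  refine ⟨Fᵀ, isInputContainingFriend_iff_dual.2 (by rwa [transpose_transpose]), ?_⟩
  rw [← eigs_subset_iff] at hs ⊢
  rwa [← eigs_mulVecLin_transpose, transpose_add, transpose_mul, transpose_transpose]

end Duality

/-! ### Transfer functions and Markov parameters -/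

section TransferFunction

open Matrix

variable {ν ρ κ : Type*} [Fintype ν] [DecidableEq ν]

theorem isUnit_det_of_notMem_eigs {a : Matrix ν ν ℝ} {l : ℂ} (hl : l ∉ eigs a.mulVecLin) :
    IsUnit (l • (1 : Matrix ν ν ℂ) - a.map (algebraMap ℝ ℂ)).det := by
  rw [isUnit_iff_ne_zero]
  intro h0
  refine hl ?_
  have hc : a.mulVecLin.charpoly = a.charpoly := by
    rw [← Matrix.toLin'_apply', Matrix.charpoly_toLin']
  rw [eigs, hc, mem_rootSet]
  refine ⟨a.charpoly_monic.ne_zero, ?_⟩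
  rw [aeval_def, ← eval_map, ← Matrix.charpoly_map, Matrix.eval_charpoly, ← h0]
  congr 2
  ext i j
  simp [Matrix.scalar_apply, Matrix.diagonal_apply, Matrix.one_apply]

/-- If a transfer function vanishes off the spectrum, then letting its argument tend to infinity
shows that the feedthrough term is zero; the transfer function shifted by one Markov parameter
vanishes as well. -/
theorem feedthrough_eq_zero_and_shift {a : Matrix ν ν ℝ} {c : Matrix ρ ν ℂ} {h : Matrix ν κ ℂ}
    {g : Matrix ρ κ ℂ}
    (H : ∀ l, l ∉ eigs a.mulVecLin →
      c * (l • (1 : Matrix ν ν ℂ) - a.map (algebraMap ℝ ℂ))⁻¹ * h + g = 0) :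
    g = 0 ∧ ∀ l, l ∉ eigs a.mulVecLin →
      c * a.map (algebraMap ℝ ℂ) * (l • (1 : Matrix ν ν ℂ) - a.map (algebraMap ℝ ℂ))⁻¹ * h +
        c * h = 0 := by
  let _ : NormedRing (Matrix ν ν ℂ) := Matrix.linftyOpNormedRing
  let _ : NormedAlgebra ℂ (Matrix ν ν ℂ) := Matrix.linftyOpNormedAlgebra
  have _ : CompleteSpace (Matrix ν ν ℂ) := FiniteDimensional.complete ℂ _
  set a' := a.map (algebraMap ℝ ℂ) with ha'
  have hg : g = 0 := by
    ext i j
    let φ : Matrix ν ν ℂ →ₗ[ℂ] ℂ :=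
      { toFun := fun M => (c * M * h) i j
        map_add' := fun M N => by rw [Matrix.mul_add, Matrix.add_mul, Matrix.add_apply]
        map_smul' := fun t M => by
          rw [Matrix.mul_smul, Matrix.smul_mul, Matrix.smul_apply, RingHom.id_apply] }
    have hφ : Continuous φ := φ.continuous_of_finiteDimensional
    have hlim : Filter.Tendsto (fun l => φ (resolvent a' l)) (Bornology.cobounded ℂ) (nhds 0) := by
      have := (hφ.tendsto 0).comp (spectrum.resolvent_tendsto_cobounded (𝕜 := ℂ) a')
      rwa [map_zero] at this
    have hev : ∀ᶠ l in Bornology.cobounded ℂ, φ (resolvent a' l) = -g i j := by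
      have hfin : (eigs a.mulVecLin).Finite := Polynomial.rootSet_finite _ _
      filter_upwards [Bornology.isBounded_def.1 hfin.isBounded] with l hl
      have h1 := congrFun (congrFun (H l hl) i) j
      rw [Matrix.add_apply, Matrix.zero_apply] at h1
      rw [← eq_neg_of_add_eq_zero_left h1, resolvent, Algebra.algebraMap_eq_smul_one,
        Matrix.nonsing_inv_eq_ringInverse]
      rfl
    have := tendsto_nhds_unique (hlim.congr' hev) tendsto_const_nhds
    rw [Matrix.zero_apply, ← neg_eq_zero, ← this]
  refine ⟨hg, fun l hl => ?_⟩
  have h1 := H l hl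
  rw [hg, add_zero] at h1
  have h2 : a' * (l • (1 : Matrix ν ν ℂ) - a')⁻¹ + 1 = l • (l • (1 : Matrix ν ν ℂ) - a')⁻¹ := by
    have h3 := Matrix.mul_nonsing_inv _ (isUnit_det_of_notMem_eigs hl)
    rw [← ha', Matrix.sub_mul, Matrix.smul_mul, Matrix.one_mul] at h3
    exact (sub_eq_iff_eq_add'.1 h3).symm
  have h4 : c * (a' * (l • (1 : Matrix ν ν ℂ) - a')⁻¹ + 1) * h = 0 := by
    rw [h2, Matrix.mul_smul, Matrix.smul_mul, h1, smul_zero]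
  rwa [Matrix.mul_add, Matrix.add_mul, Matrix.mul_one, ← Matrix.mul_assoc] at h4

/-- A transfer function vanishes off the spectrum if and only if its Markov parameters do. -/
theorem forall_transferFunction_eq_zero_iff (a : Matrix ν ν ℝ) (c : Matrix ρ ν ℝ)
    (h : Matrix ν κ ℝ) (g : Matrix ρ κ ℝ) :
    (∀ l, l ∉ eigs a.mulVecLin → c.map (algebraMap ℝ ℂ) *
      (l • (1 : Matrix ν ν ℂ) - a.map (algebraMap ℝ ℂ))⁻¹ * h.map (algebraMap ℝ ℂ) +
        g.map (algebraMap ℝ ℂ) = 0) ↔ g = 0 ∧ ∀ k : ℕ, c * a ^ k * h = 0 := by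
  have hinj : ∀ M : Matrix ρ κ ℝ, M.map (algebraMap ℝ ℂ) = 0 → M = 0 := fun M hM => by
    ext i j
    simpa using congrFun (congrFun hM i) j
  constructor
  · intro H
    have key : ∀ k : ℕ, ∀ l, l ∉ eigs a.mulVecLin →
        (c * a ^ k * a).map (algebraMap ℝ ℂ) *
          (l • (1 : Matrix ν ν ℂ) - a.map (algebraMap ℝ ℂ))⁻¹ * h.map (algebraMap ℝ ℂ) +
            (c * a ^ k * h).map (algebraMap ℝ ℂ) = 0 := by
      intro k
      induction k with
      | zero =>
        intro l hl
        have := (feedthrough_eq_zero_and_shift H).2 l hl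
        simpa only [pow_zero, Matrix.mul_one, Matrix.map_mul] using this
      | succ k ih =>
        intro l hl
        have := (feedthrough_eq_zero_and_shift ih).2 l hl
        simpa only [pow_succ, ← Matrix.mul_assoc, Matrix.map_mul] using this
    exact ⟨hinj _ (feedthrough_eq_zero_and_shift H).1,
      fun k => hinj _ (feedthrough_eq_zero_and_shift (key k)).1⟩
  · rintro ⟨rfl, hk⟩ l hl
    -- By the theorem of Cayley and Hamilton the resolvent is a polynomial in the matrix.
    set a' := a.map (algebraMap ℝ ℂ) with ha'
    have hk' : ∀ k : ℕ, c.map (algebraMap ℝ ℂ) * a' ^ k * h.map (algebraMap ℝ ℂ) = 0 := by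
      intro k
      have : a' ^ k = (a ^ k).map (algebraMap ℝ ℂ) :=
        (map_pow (algebraMap ℝ ℂ).mapMatrix a k).symm
      rw [this, ← Matrix.map_mul, ← Matrix.map_mul, hk]
      ext i j
      simp
    set M := l • (1 : Matrix ν ν ℂ) - a' with hM
    have hdet : IsUnit M.det := isUnit_det_of_notMem_eigs hl
    have hχ : a'.charpoly.eval l ≠ 0 := by
      rw [Matrix.eval_charpoly]
      have : (Matrix.scalar ν) l - a' = M := by
        rw [hM]
        congr 1
        ext i j
        simp [Matrix.scalar_apply, Matrix.diagonal_apply, Matrix.one_apply]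
      rw [this]
      exact hdet.ne_zero
    obtain ⟨q, hq⟩ : X - Polynomial.C l ∣ a'.charpoly - Polynomial.C (a'.charpoly.eval l) :=
      X_sub_C_dvd_sub_C_eval
    have h1 := congrArg (aeval a') hq
    rw [map_sub, Matrix.aeval_self_charpoly, map_mul, map_sub, aeval_X, aeval_C, aeval_C,
      zero_sub, Algebra.algebraMap_eq_smul_one, Algebra.algebraMap_eq_smul_one] at h1
    have h2 : M * aeval a' q = a'.charpoly.eval l • 1 := by
      rw [← neg_inj, h1, hM, ← Matrix.neg_mul, neg_sub]
    have h3 : a'.charpoly.eval l • M⁻¹ = aeval a' q := by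
      rw [← Matrix.nonsing_inv_mul_cancel_left M (aeval a' q) hdet, h2, Matrix.mul_smul,
        Matrix.mul_one]
    have h4 : c.map (algebraMap ℝ ℂ) * aeval a' q * h.map (algebraMap ℝ ℂ) = 0 := by
      rw [aeval_eq_sum_range, Matrix.mul_sum, Matrix.sum_mul]
      refine Finset.sum_eq_zero fun i _ => ?_
      rw [Matrix.mul_smul, Matrix.smul_mul, hk', smul_zero]
    rw [← h3, Matrix.mul_smul, Matrix.smul_mul, smul_eq_zero] at h4
    rw [h4.resolve_left hχ, zero_add]
    ext i j
    simp

end TransferFunction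

/-! ### The subspaces attached to a plant -/

namespace Plant

open Matrix

variable {n m q p r s : ℕ} (P : Plant n m q p r)

/-- `S⋆` of the quadruple `(A, [B H], E, [D_z G_z])`, in which the disturbance is treated as a
control. -/
def Sext : Submodule ℝ (Fin n → ℝ) :=
  Sstar P.A (fromCols P.B P.H) P.E (fromCols P.Dz P.Gz)

/-- `V⋆` of the quadruple `(A, H, [C; E], [G_y; G_z])`, in which the controlled output is treated as
a measurement. -/
def Vext : Submodule ℝ (Fin n → ℝ) :=
  Vstar P.A P.H (fromRows P.C P.E) (fromRows P.Gy P.Gz)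

/-- The subspace `V⋆ ⊓ S⋆` of the quadruple `(A, B, E, D_z)`. -/
def Rst : Submodule ℝ (Fin n → ℝ) :=
  P.Vst ⊓ Sstar P.A P.B P.E P.Dz

/-- Every disturbance can be compensated by a control modulo `V`, without effect on the controlled
output. -/
def Absorbs (V : Submodule ℝ (Fin n → ℝ)) : Prop :=
  ∀ w, ∃ u, P.H *ᵥ w + P.B *ᵥ u ∈ V ∧ P.Gz *ᵥ w + P.Dz *ᵥ u = 0

/-- Pairs of a state in `S` and a disturbance that are not seen by the measurement are not seen by
the controlled output. -/
def Hides (S : Submodule ℝ (Fin n → ℝ)) : Prop :=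
  ∀ x ∈ S, ∀ w, P.C *ᵥ x + P.Gy *ᵥ w = 0 → P.E *ᵥ x + P.Gz *ᵥ w = 0

/-- The static feedback `K` steers every state in `S` into `V` with zero controlled output, whatever
the disturbance. -/
def Steers (K : Matrix (Fin m) (Fin p) ℝ) (S V : Submodule ℝ (Fin n → ℝ)) : Prop :=
  ∀ x ∈ S, ∀ w,
    P.A *ᵥ x + P.B *ᵥ (K *ᵥ (P.C *ᵥ x + P.Gy *ᵥ w)) + P.H *ᵥ w ∈ V ∧
    P.E *ᵥ x + P.Dz *ᵥ (K *ᵥ (P.C *ᵥ x + P.Gy *ᵥ w)) + P.Gz *ᵥ w = 0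

theorem absorbs_iff {V : Submodule ℝ (Fin n → ℝ)} : P.Absorbs V ↔
    LinearMap.range (P.H.mulVecLin.prod P.Gz.mulVecLin) ≤
      V.prod (⊥ : Submodule ℝ (Fin r → ℝ)) ⊔
        LinearMap.range (P.B.mulVecLin.prod P.Dz.mulVecLin) := by
  constructor
  · rintro h _ ⟨w, rfl⟩
    exact mem_prod_bot_sup_range.2 (h w)
  · exact fun h w => mem_prod_bot_sup_range.1 (h ⟨w, rfl⟩)

theorem hides_iff {S : Submodule ℝ (Fin n → ℝ)} : P.Hides S ↔
    S.prod (⊤ : Submodule ℝ (Fin q → ℝ)) ⊓ LinearMap.ker (P.C.mulVecLin.coprod P.Gy.mulVecLin) ≤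
      LinearMap.ker (P.E.mulVecLin.coprod P.Gz.mulVecLin) := by
  constructor
  · rintro h ⟨x, w⟩ ⟨⟨hx, -⟩, hw⟩
    exact h x hx w hw
  · intro h x hx w hw
    exact h (show (x, w) ∈ _ from ⟨⟨hx, trivial⟩, hw⟩)

theorem steers_iff {K : Matrix (Fin m) (Fin p) ℝ} {S V : Submodule ℝ (Fin n → ℝ)} :
    P.Steers K S V ↔ (S.prod (⊤ : Submodule ℝ (Fin q → ℝ))).map (P.feedbackBlock K) ≤
      V.prod (⊥ : Submodule ℝ (Fin r → ℝ)) := by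
  have e : ∀ x w, P.feedbackBlock K (x, w) =
      (P.A *ᵥ x + P.B *ᵥ (K *ᵥ (P.C *ᵥ x + P.Gy *ᵥ w)) + P.H *ᵥ w,
        P.E *ᵥ x + P.Dz *ᵥ (K *ᵥ (P.C *ᵥ x + P.Gy *ᵥ w)) + P.Gz *ᵥ w) := by
    intro x w
    refine Prod.ext ?_ ?_
    · change (P.A + P.B * K * P.C) *ᵥ x + (P.H + P.B * K * P.Gy) *ᵥ w = _
      simp only [add_mulVec, ← mulVec_mulVec, mulVec_add]
      abel
    · change (P.E + P.Dz * K * P.C) *ᵥ x + (P.Gz + P.Dz * K * P.Gy) *ᵥ w = _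
      simp only [add_mulVec, ← mulVec_mulVec, mulVec_add]
      abel
  rw [Submodule.map_le_iff_le_comap]
  constructor
  · rintro h ⟨x, w⟩ ⟨hx, -⟩
    rw [Submodule.mem_comap, e]
    exact h x hx w
  · intro h x hx w
    have := h (show (x, w) ∈ _ from ⟨hx, trivial⟩)
    rw [Submodule.mem_comap, e] at this
    exact this

variable {P}

theorem isOutputNulling_ext_iff {V : Submodule ℝ (Fin n → ℝ)} :
    IsOutputNulling P.A (fromCols P.B P.H) P.E (fromCols P.Dz P.Gz) V ↔
      ∀ x ∈ V, ∃ u w, P.A *ᵥ x + P.B *ᵥ u + P.H *ᵥ w ∈ V ∧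
        P.E *ᵥ x + P.Dz *ᵥ u + P.Gz *ᵥ w = 0 := by
  rw [isOutputNulling_iff]
  refine forall₂_congr fun x _ => ?_
  constructor
  · rintro ⟨u, h1, h2⟩
    rw [fromCols_mulVec, ← add_assoc] at h1 h2
    exact ⟨_, _, h1, h2⟩
  · rintro ⟨u, w, h1, h2⟩
    refine ⟨Sum.elim u w, ?_, ?_⟩
    · rw [fromCols_mulVec, ← add_assoc]; exact h1
    · rw [fromCols_mulVec, ← add_assoc]; exact h2

theorem isInputContaining_ext_iff {S : Submodule ℝ (Fin n → ℝ)} :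
    IsInputContaining P.A (fromCols P.B P.H) P.E (fromCols P.Dz P.Gz) S ↔
      ∀ x ∈ S, ∀ u w, P.E *ᵥ x + P.Dz *ᵥ u + P.Gz *ᵥ w = 0 →
        P.A *ᵥ x + P.B *ᵥ u + P.H *ᵥ w ∈ S := by
  rw [isInputContaining_iff]
  refine forall₂_congr fun x _ => ?_
  constructor
  · intro h u w h0
    have := h (Sum.elim u w) (by rw [fromCols_mulVec, ← add_assoc]; exact h0)
    rw [fromCols_mulVec, ← add_assoc] at this
    exact this
  · intro h u h0
    rw [fromCols_mulVec, ← add_assoc] at h0 ⊢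
    exact h _ _ h0

theorem mem_Sext_of_step {x : Fin n → ℝ} (hx : x ∈ P.Sext) {u : Fin m → ℝ} {w : Fin q → ℝ}
    (h0 : P.E *ᵥ x + P.Dz *ᵥ u + P.Gz *ᵥ w = 0) : P.A *ᵥ x + P.B *ᵥ u + P.H *ᵥ w ∈ P.Sext :=
  isInputContaining_ext_iff.1 isInputContaining_Sstar x hx u w h0

theorem exists_step_of_mem_Vst {x : Fin n → ℝ} (hx : x ∈ P.Vst) :
    ∃ u, P.A *ᵥ x + P.B *ᵥ u ∈ P.Vst ∧ P.E *ᵥ x + P.Dz *ᵥ u = 0 :=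
  isOutputNulling_iff.1 isOutputNulling_Vstar x hx

/-- If `V⋆` absorbs the disturbances, then using the disturbance as a control does not
enlarge `V⋆`. -/
theorem Vm_eq (hA : P.Absorbs P.Vst) : P.Vm = P.Vst ⊓ P.Sext := by
  have hV : Vstar P.A (fromCols P.B P.H) P.E (fromCols P.Dz P.Gz) = P.Vst := by
    refine le_antisymm ?_ ?_
    · set V := Vstar P.A (fromCols P.B P.H) P.E (fromCols P.Dz P.Gz)
      have hON : IsOutputNulling P.A P.B P.E P.Dz (V ⊔ P.Vst) := by
        refine isOutputNulling_iff.2 fun y hy => ?_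
        obtain ⟨v, hv, x, hx, rfl⟩ := Submodule.mem_sup.1 hy
        obtain ⟨u₁, w, h₁, h₂⟩ := isOutputNulling_ext_iff.1 isOutputNulling_Vstar v hv
        obtain ⟨u₂, h₃, h₄⟩ := hA w
        obtain ⟨u₃, h₅, h₆⟩ := exists_step_of_mem_Vst hx
        refine ⟨u₁ - u₂ + u₃, ?_, ?_⟩
        · convert Submodule.add_mem_sup h₁ (Submodule.sub_mem _ h₅ h₃) using 1
          simp only [mulVec_add, mulVec_sub]
          abel
        · have := congrArg₂ (· - ·) (congrArg₂ (· + ·) h₂ h₆) h₄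
          simp only [add_zero, sub_zero] at this
          rw [← this]
          simp only [mulVec_add, mulVec_sub]
          abel
      exact le_sup_left.trans (le_Vstar hON)
    · refine le_Vstar (isOutputNulling_ext_iff.2 fun x hx => ?_)
      obtain ⟨u, h1, h2⟩ := exists_step_of_mem_Vst hx
      exact ⟨u, 0, by simpa using h1, by simpa using h2⟩
  rw [Vm, Rstar_eq, hV, Sext]

theorem mem_Vm_of_step (hA : P.Absorbs P.Vst) {x : Fin n → ℝ} (hx : x ∈ P.Sext) {u : Fin m → ℝ}
    {w : Fin q → ℝ} (h : P.A *ᵥ x + P.B *ᵥ u + P.H *ᵥ w ∈ P.Vst)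
    (h0 : P.E *ᵥ x + P.Dz *ᵥ u + P.Gz *ᵥ w = 0) :
    P.A *ᵥ x + P.B *ᵥ u + P.H *ᵥ w ∈ P.Vm := by
  rw [Vm_eq hA]
  exact ⟨h, mem_Sext_of_step hx h0⟩

/-- Two ways of keeping a state in `V⋆` with zero controlled output differ by a vector of `V_m`. -/
theorem sub_mem_Vm (hA : P.Absorbs P.Vst) {x : Fin n → ℝ} {u₁ u₂ : Fin m → ℝ}
    {w₁ w₂ : Fin q → ℝ} (h₁ : P.A *ᵥ x + P.B *ᵥ u₁ + P.H *ᵥ w₁ ∈ P.Vst)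
    (h₁' : P.E *ᵥ x + P.Dz *ᵥ u₁ + P.Gz *ᵥ w₁ = 0)
    (h₂ : P.A *ᵥ x + P.B *ᵥ u₂ + P.H *ᵥ w₂ ∈ P.Vst)
    (h₂' : P.E *ᵥ x + P.Dz *ᵥ u₂ + P.Gz *ᵥ w₂ = 0) :
    P.A *ᵥ x + P.B *ᵥ u₁ + P.H *ᵥ w₁ - (P.A *ᵥ x + P.B *ᵥ u₂ + P.H *ᵥ w₂) ∈ P.Vm := by
  have e : P.A *ᵥ x + P.B *ᵥ u₁ + P.H *ᵥ w₁ - (P.A *ᵥ x + P.B *ᵥ u₂ + P.H *ᵥ w₂) =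
      P.A *ᵥ (0 : Fin n → ℝ) + P.B *ᵥ (u₁ - u₂) + P.H *ᵥ (w₁ - w₂) := by
    simp only [mulVec_sub, mulVec_zero]
    abel
  have e' : P.E *ᵥ (0 : Fin n → ℝ) + P.Dz *ᵥ (u₁ - u₂) + P.Gz *ᵥ (w₁ - w₂) = 0 := by
    have := congrArg₂ (· - ·) h₁' h₂'
    simp only [sub_zero] at this
    rw [← this]
    simp only [mulVec_sub, mulVec_zero]
    abel
  have h := Submodule.sub_mem _ h₁ h₂
  rw [e] at h ⊢
  exact mem_Vm_of_step hA (Submodule.zero_mem _) h e'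

theorem isOutputNulling_Vm (hA : P.Absorbs P.Vst) : IsOutputNulling P.A P.B P.E P.Dz P.Vm := by
  refine isOutputNulling_iff.2 fun x hx => ?_
  rw [Vm_eq hA] at hx
  obtain ⟨u, h1, h2⟩ := exists_step_of_mem_Vst hx.1
  refine ⟨u, ?_, h2⟩
  have := mem_Vm_of_step hA hx.2 (u := u) (w := 0) (by simpa using h1) (by simpa using h2)
  simpa using this

theorem Rst_le_Vm (hA : P.Absorbs P.Vst) : P.Rst ≤ P.Vm := by
  rw [Vm_eq hA]
  refine inf_le_inf_left _ (Sstar_le (isInputContaining_iff.2 fun x hx u h0 => ?_))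
  have := mem_Sext_of_step hx (u := u) (w := 0) (by simpa using h0)
  simpa using this

/-- Among the output nulling subspaces that contain `V⋆ ⊓ S⋆` and absorb the disturbances, `V_m` is
the smallest. -/
theorem Vm_le {V : Submodule ℝ (Fin n → ℝ)} (hA : P.Absorbs P.Vst)
    (hV : IsOutputNulling P.A P.B P.E P.Dz V) (hR : P.Rst ≤ V) (hAV : P.Absorbs V) :
    P.Vm ≤ V := by
  have hIC : IsInputContaining P.A (fromCols P.B P.H) P.E (fromCols P.Dz P.Gz)
      (V ⊔ Sstar P.A P.B P.E P.Dz) := by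
    refine isInputContaining_ext_iff.2 fun x hx u w h0 => ?_
    obtain ⟨v, hv, t, ht, rfl⟩ := Submodule.mem_sup.1 hx
    obtain ⟨u₁, h₁, h₂⟩ := isOutputNulling_iff.1 hV v hv
    obtain ⟨u₂, h₃, h₄⟩ := hAV w
    have h5 := isInputContaining_iff.1 isInputContaining_Sstar t ht (u - u₁ - u₂) (by
      have := congrArg₂ (· - ·) (congrArg₂ (· - ·) h0 h₂) h₄
      simp only [sub_zero] at this
      rw [← this]
      simp only [mulVec_add, mulVec_sub]
      abel)
    convert Submodule.add_mem_sup (V.add_mem h₁ h₃) h5 using 1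
    simp only [mulVec_add, mulVec_sub]
    abel
  rw [Vm_eq hA]
  rintro x ⟨hxV, hxS⟩
  obtain ⟨v, hv, t, ht, rfl⟩ := Submodule.mem_sup.1 (Sstar_le hIC hxS)
  have htV : t ∈ P.Vst := by simpa using P.Vst.sub_mem hxV (le_Vstar hV hv)
  exact V.add_mem hv (hR ⟨htV, ht⟩)

theorem exists_step_of_mem_Vext {x : Fin n → ℝ} (hx : x ∈ P.Vext) :
    ∃ w, P.A *ᵥ x + P.H *ᵥ w ∈ P.Vext ∧ P.C *ᵥ x + P.Gy *ᵥ w = 0 ∧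
      P.E *ᵥ x + P.Gz *ᵥ w = 0 := by
  obtain ⟨w, h1, h2⟩ := isOutputNulling_iff.1 isOutputNulling_Vstar x hx
  rw [fromRows_mulVec, fromRows_mulVec] at h2
  exact ⟨w, h1, funext fun i => congrFun h2 (Sum.inl i), funext fun i => congrFun h2 (Sum.inr i)⟩

/-- If `S⋆` hides the controlled output, then measuring it in addition does not reduce `S⋆`. -/
theorem Sstar_fromRows_eq (hB : P.Hides P.Sst) :
    Sstar P.A P.H (fromRows P.C P.E) (fromRows P.Gy P.Gz) = P.Sst := by
  set S := Sstar P.A P.H (fromRows P.C P.E) (fromRows P.Gy P.Gz) with hS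
  refine le_antisymm ?_ ?_
  · refine Sstar_le (isInputContaining_iff.2 fun x hx w h0 => ?_)
    rw [fromRows_mulVec, fromRows_mulVec] at h0
    exact isInputContaining_iff.1 isInputContaining_Sstar x hx w
      (funext fun i => congrFun h0 (Sum.inl i))
  · have hIC : IsInputContaining P.A P.H P.C P.Gy (S ⊓ P.Sst) := by
      refine isInputContaining_iff.2 fun x hx w h0 => ⟨?_, ?_⟩
      · refine isInputContaining_iff.1 isInputContaining_Sstar x hx.1 w ?_
        rw [fromRows_mulVec, fromRows_mulVec]
        ext i
        cases i with
        | inl i => exact congrFun h0 i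
        | inr i => exact congrFun (hB x hx.2 w h0) i
      · exact isInputContaining_iff.1 isInputContaining_Sstar x hx.2 w h0
    exact (Sstar_le hIC).trans inf_le_left

theorem SM_eq (hB : P.Hides P.Sst) : P.SM = P.Sst ⊔ P.Vext := by
  rw [SM, Qstar_eq, Sstar_fromRows_eq hB, Vext]

theorem Sst_le_Sext (hB : P.Hides P.Sst) : P.Sst ≤ P.Sext := by
  rw [← Sstar_fromRows_eq hB]
  refine Sstar_le (isInputContaining_iff.2 fun x hx w h0 => ?_)
  rw [fromRows_mulVec, fromRows_mulVec] at h0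
  have hE : P.E *ᵥ x + P.Gz *ᵥ w = 0 := funext fun i => congrFun h0 (Sum.inr i)
  simpa using mem_Sext_of_step hx (u := 0) (w := w) (by simpa using hE)

theorem isOutputNulling_sup_Vext {V : Submodule ℝ (Fin n → ℝ)} (hV : P.Absorbs V)
    (hON : IsOutputNulling P.A P.B P.E P.Dz V) :
    IsOutputNulling P.A P.B P.E P.Dz (V ⊔ P.Vext) := by
  refine isOutputNulling_iff.2 fun y hy => ?_
  obtain ⟨v, hv, x, hx, rfl⟩ := Submodule.mem_sup.1 hy
  obtain ⟨u₁, h₁, h₂⟩ := isOutputNulling_iff.1 hON v hv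
  obtain ⟨w, h₃, -, h₄⟩ := exists_step_of_mem_Vext hx
  obtain ⟨u₂, h₅, h₆⟩ := hV w
  refine ⟨u₁ - u₂, ?_, ?_⟩
  · convert Submodule.add_mem_sup (V.sub_mem h₁ h₅) h₃ using 1
    simp only [mulVec_add, mulVec_sub]
    abel
  · have := congrArg₂ (· - ·) (congrArg₂ (· + ·) h₂ h₄) h₆
    simp only [add_zero, sub_zero] at this
    rw [← this]
    simp only [mulVec_add, mulVec_sub]
    abel

theorem Vext_le_Vst (hA : P.Absorbs P.Vst) : P.Vext ≤ P.Vst :=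
  le_sup_right.trans (le_Vstar (isOutputNulling_sup_Vext hA isOutputNulling_Vstar))

theorem steers_Vm {K : Matrix (Fin m) (Fin p) ℝ} (hA : P.Absorbs P.Vst) (hB : P.Hides P.Sst)
    (hF : P.Steers K P.Sst P.Vst) : P.Steers K P.Sst P.Vm := fun x hx w =>
  ⟨mem_Vm_of_step hA (Sst_le_Sext hB hx) (hF x hx w).1 (hF x hx w).2, (hF x hx w).2⟩

/-- A feedback that steers `S⋆` into `V⋆` steers `S_M` into `V_m + S_M`. -/
theorem steers_SM {K : Matrix (Fin m) (Fin p) ℝ} (hA : P.Absorbs P.Vst) (hB : P.Hides P.Sst)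
    (hF : P.Steers K P.Sst P.Vst) : P.Steers K P.SM (P.Vm ⊔ P.SM) := by
  intro y hy w
  rw [SM_eq hB] at hy
  obtain ⟨t, ht, x, hx, rfl⟩ := Submodule.mem_sup.1 hy
  -- On the summand `x` the unmeasured disturbance `w₀` is used, the rest of `w` goes with `t`.
  obtain ⟨w₀, h₁, h₂, h₃⟩ := exists_step_of_mem_Vext hx
  have h₄ := steers_Vm hA hB hF t ht (w - w₀)
  have hy : P.C *ᵥ (t + x) + P.Gy *ᵥ w = P.C *ᵥ t + P.Gy *ᵥ (w - w₀) := by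
    rw [← sub_eq_zero, ← h₂]
    simp only [mulVec_add, mulVec_sub]
    abel
  rw [hy]
  constructor
  · have hx' : P.A *ᵥ x + P.H *ᵥ w₀ ∈ P.SM := by
      rw [SM_eq hB]; exact Submodule.mem_sup_right h₁
    convert Submodule.add_mem_sup h₄.1 hx' using 1
    simp only [mulVec_add, mulVec_sub]
    abel
  · have := congrArg₂ (· + ·) h₄.2 h₃
    simp only [add_zero] at this
    rw [← this]
    simp only [mulVec_add, mulVec_sub]
    abel

theorem isOutputNulling_Vm_sup_SM {K : Matrix (Fin m) (Fin p) ℝ} (hA : P.Absorbs P.Vst)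
    (hB : P.Hides P.Sst) (hF : P.Steers K P.Sst P.Vst) :
    IsOutputNulling P.A P.B P.E P.Dz (P.Vm ⊔ P.SM) := by
  refine isOutputNulling_iff.2 fun y hy => ?_
  obtain ⟨v, hv, x, hx, rfl⟩ := Submodule.mem_sup.1 hy
  obtain ⟨u₁, h₁, h₂⟩ := isOutputNulling_iff.1 (isOutputNulling_Vm hA) v hv
  have h₃ := steers_SM hA hB hF x hx 0
  simp only [mulVec_zero, add_zero] at h₃
  refine ⟨u₁ + K *ᵥ (P.C *ᵥ x), ?_, ?_⟩
  · convert Submodule.add_mem _ (Submodule.mem_sup_left h₁) h₃.1 using 1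
    simp only [mulVec_add]
    abel
  · have := congrArg₂ (· + ·) h₂ h₃.2
    simp only [add_zero] at this
    rw [← this]
    simp only [mulVec_add]
    abel

end Plant

namespace Plant

open Matrix

variable {n m q p r s : ℕ}

/-! ### The closed loop of a plant without direct feedthrough from control to measurement -/

section ClosedLoop

variable {P : Plant n m q p r} {K : Compensator s m p}

theorem W_of_Dy_eq_zero (h : P.Dy = 0) : P.W K = 1 := by
  rw [W, h, Matrix.zero_mul, sub_zero, inv_one]

theorem Ahat_of_Dy_eq_zero (h : P.Dy = 0) : P.Ahat K =
    fromBlocks (P.A + P.B * K.Dc * P.C) (P.B * K.Cc) (K.Bc * P.C) K.Ac := by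
  simp [Ahat, W_of_Dy_eq_zero h, h]

theorem Hhat_of_Dy_eq_zero (h : P.Dy = 0) : P.Hhat K =
    fromRows (P.H + P.B * K.Dc * P.Gy) (K.Bc * P.Gy) := by
  simp [Hhat, W_of_Dy_eq_zero h]

theorem Chat_of_Dy_eq_zero (h : P.Dy = 0) : P.Chat K =
    fromCols (P.E + P.Dz * K.Dc * P.C) (P.Dz * K.Cc) := by
  simp [Chat, W_of_Dy_eq_zero h, h]

theorem Ghat_of_Dy_eq_zero (h : P.Dy = 0) : P.Ghat K = P.Gz + P.Dz * K.Dc * P.Gy := by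
  simp [Ghat, W_of_Dy_eq_zero h]

theorem Ahat_mulVec (h : P.Dy = 0) (x : Fin n → ℝ) (ξ : Fin s → ℝ) :
    P.Ahat K *ᵥ Sum.elim x ξ =
      Sum.elim (P.A *ᵥ x + P.B *ᵥ (K.Dc *ᵥ (P.C *ᵥ x) + K.Cc *ᵥ ξ))
        (K.Bc *ᵥ (P.C *ᵥ x) + K.Ac *ᵥ ξ) := by
  rw [Ahat_of_Dy_eq_zero h, fromBlocks_mulVec]
  simp only [Sum.elim_comp_inl, Sum.elim_comp_inr, add_mulVec, ← mulVec_mulVec, mulVec_add,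
    add_assoc]

theorem Hhat_mulVec (h : P.Dy = 0) (w : Fin q → ℝ) :
    P.Hhat K *ᵥ w = Sum.elim (P.H *ᵥ w + P.B *ᵥ (K.Dc *ᵥ (P.Gy *ᵥ w)))
      (K.Bc *ᵥ (P.Gy *ᵥ w)) := by
  rw [Hhat_of_Dy_eq_zero h, fromRows_mulVec]
  simp only [add_mulVec, ← mulVec_mulVec]

theorem Chat_mulVec (h : P.Dy = 0) (x : Fin n → ℝ) (ξ : Fin s → ℝ) :
    P.Chat K *ᵥ Sum.elim x ξ =
      P.E *ᵥ x + P.Dz *ᵥ (K.Dc *ᵥ (P.C *ᵥ x) + K.Cc *ᵥ ξ) := by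
  rw [Chat_of_Dy_eq_zero h, fromCols_mulVec]
  simp only [Sum.elim_comp_inl, Sum.elim_comp_inr, add_mulVec, ← mulVec_mulVec, mulVec_add,
    add_assoc]

theorem Ghat_mulVec (h : P.Dy = 0) (w : Fin q → ℝ) :
    P.Ghat K *ᵥ w = P.Gz *ᵥ w + P.Dz *ᵥ (K.Dc *ᵥ (P.Gy *ᵥ w)) := by
  rw [Ghat_of_Dy_eq_zero h]
  simp only [add_mulVec, ← mulVec_mulVec]

end ClosedLoop

/-- The closed loop of `P` and `K` is stable and decoupled, and the control does not enter the
measurement of `P`. Decoupling is expressed by the Markov parameters. -/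
structure IsDecouplingLoop (τ : TimeDomain) (P : Plant n m q p r) (K : Compensator s m p) :
    Prop where
  Dy_eq : P.Dy = 0
  Ghat_eq : P.Ghat K = 0
  markov : ∀ k : ℕ, P.Chat K * P.Ahat K ^ k * P.Hhat K = 0
  stable : P.closedLoopSpectrum K ⊆ τ.stableRegion

theorem isDecoupled_iff {P : Plant n m q p r} {K : Compensator s m p} : P.IsDecoupled K ↔
    P.Ghat K = 0 ∧ ∀ k : ℕ, P.Chat K * P.Ahat K ^ k * P.Hhat K = 0 :=
  forall_transferFunction_eq_zero_iff _ _ _ _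

/-! ### Necessity -/

/-- The subspace of closed-loop states that are not seen by the controlled output. -/
noncomputable def unobservable (P : Plant n m q p r) (K : Compensator s m p) :
    Submodule ℝ (Fin n ⊕ Fin s → ℝ) :=
  ⨅ k : ℕ, LinearMap.ker (P.Chat K * P.Ahat K ^ k).mulVecLin

/-- The projection of the unobservable subspace of the closed loop to the state space of the
plant. -/
noncomputable def projUnobservable (P : Plant n m q p r) (K : Compensator s m p) :
    Submodule ℝ (Fin n → ℝ) :=
  (P.unobservable K).map (LinearMap.funLeft ℝ ℝ Sum.inl)

/-- The embedding of the state space of the plant into that of the closed loop. -/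
def embed (n s : ℕ) : (Fin n → ℝ) →ₗ[ℝ] (Fin n ⊕ Fin s → ℝ) where
  toFun x := Sum.elim x 0
  map_add' x y := by ext i; cases i <;> simp
  map_smul' c x := by ext i; cases i <;> simp

theorem embed_apply (x : Fin n → ℝ) : embed n s x = Sum.elim x 0 := rfl

/-- The intersection of the unobservable subspace of the closed loop with the state space of the
plant. -/
noncomputable def interUnobservable (P : Plant n m q p r) (K : Compensator s m p) :
    Submodule ℝ (Fin n → ℝ) :=
  (P.unobservable K).comap (embed n s)

theorem mem_unobservable {P : Plant n m q p r} {K : Compensator s m p}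
    {v : Fin n ⊕ Fin s → ℝ} :
    v ∈ P.unobservable K ↔ ∀ k : ℕ, (P.Chat K * P.Ahat K ^ k) *ᵥ v = 0 := by
  simp [unobservable, Submodule.mem_iInf]

theorem mem_projUnobservable {P : Plant n m q p r} {K : Compensator s m p} {x : Fin n → ℝ} :
    x ∈ P.projUnobservable K ↔ ∃ ξ, Sum.elim x ξ ∈ P.unobservable K := by
  constructor
  · rintro ⟨v, hv, rfl⟩
    refine ⟨v ∘ Sum.inr, ?_⟩
    change Sum.elim (v ∘ Sum.inl) (v ∘ Sum.inr) ∈ _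
    rwa [Sum.elim_comp_inl_inr]
  · rintro ⟨ξ, h⟩
    exact ⟨_, h, rfl⟩

theorem interUnobservable_le {P : Plant n m q p r} {K : Compensator s m p} :
    P.interUnobservable K ≤ P.projUnobservable K :=
  fun _ hx => mem_projUnobservable.2 ⟨0, hx⟩

theorem Ahat_mulVec_mem {P : Plant n m q p r} {K : Compensator s m p} :
    ∀ v ∈ P.unobservable K, (P.Ahat K).mulVecLin v ∈ P.unobservable K := by
  intro v hv
  rw [mem_unobservable] at hv ⊢
  intro k
  rw [mulVecLin_apply, mulVec_mulVec, Matrix.mul_assoc, ← pow_succ]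
  exact hv (k + 1)

namespace IsDecouplingLoop

variable {τ : TimeDomain} {P : Plant n m q p r} {K : Compensator s m p}

theorem Hhat_mulVec_mem (h : IsDecouplingLoop τ P K) (w : Fin q → ℝ) :
    P.Hhat K *ᵥ w ∈ P.unobservable K := by
  rw [mem_unobservable]
  intro k
  rw [mulVec_mulVec, h.markov, zero_mulVec]

theorem output_eq_zero (h : IsDecouplingLoop τ P K) {x : Fin n → ℝ} {ξ : Fin s → ℝ}
    (hv : Sum.elim x ξ ∈ P.unobservable K) :
    P.E *ᵥ x + P.Dz *ᵥ (K.Dc *ᵥ (P.C *ᵥ x) + K.Cc *ᵥ ξ) = 0 := by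
  have := mem_unobservable.1 hv 0
  rwa [pow_zero, Matrix.mul_one, Chat_mulVec h.Dy_eq] at this

theorem feedthrough_eq_zero (h : IsDecouplingLoop τ P K) (w : Fin q → ℝ) :
    P.Gz *ᵥ w + P.Dz *ᵥ (K.Dc *ᵥ (P.Gy *ᵥ w)) = 0 := by
  rw [← Ghat_mulVec h.Dy_eq, h.Ghat_eq, zero_mulVec]

theorem isOutputNulling_projUnobservable (h : IsDecouplingLoop τ P K) :
    IsOutputNulling P.A P.B P.E P.Dz (P.projUnobservable K) := by
  refine isOutputNulling_iff.2 fun x hx => ?_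
  obtain ⟨ξ, hξ⟩ := mem_projUnobservable.1 hx
  refine ⟨_, mem_projUnobservable.2 ⟨K.Bc *ᵥ (P.C *ᵥ x) + K.Ac *ᵥ ξ, ?_⟩, h.output_eq_zero hξ⟩
  rw [← Ahat_mulVec h.Dy_eq]
  exact Ahat_mulVec_mem _ hξ

theorem absorbs_projUnobservable (h : IsDecouplingLoop τ P K) :
    P.Absorbs (P.projUnobservable K) := fun w =>
  ⟨_, mem_projUnobservable.2 ⟨_, Hhat_mulVec h.Dy_eq w ▸ h.Hhat_mulVec_mem w⟩,
    h.feedthrough_eq_zero w⟩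

theorem projUnobservable_le_Vst (h : IsDecouplingLoop τ P K) : P.projUnobservable K ≤ P.Vst :=
  le_Vstar h.isOutputNulling_projUnobservable

theorem absorbs_Vst (h : IsDecouplingLoop τ P K) : P.Absorbs P.Vst := fun w =>
  let ⟨u, h1, h2⟩ := h.absorbs_projUnobservable w
  ⟨u, h.projUnobservable_le_Vst h1, h2⟩

/-- The closed-loop motion out of a state of the plant, with compensator state zero. -/
theorem Ahat_embed_add (h : IsDecouplingLoop τ P K) (x : Fin n → ℝ) (w : Fin q → ℝ) :
    P.Ahat K *ᵥ embed n s x + P.Hhat K *ᵥ w =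
      Sum.elim (P.A *ᵥ x + P.B *ᵥ (K.Dc *ᵥ (P.C *ᵥ x + P.Gy *ᵥ w)) + P.H *ᵥ w)
        (K.Bc *ᵥ (P.C *ᵥ x + P.Gy *ᵥ w)) := by
  rw [embed_apply, Ahat_mulVec h.Dy_eq, Hhat_mulVec h.Dy_eq]
  simp only [mulVec_zero, add_zero, mulVec_add]
  ext i
  cases i with
  | inl i => simp only [Pi.add_apply, Sum.elim_inl]; ring
  | inr i => simp only [Pi.add_apply, Sum.elim_inr]

theorem steers_interUnobservable (h : IsDecouplingLoop τ P K) :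
    P.Steers K.Dc (P.interUnobservable K) (P.projUnobservable K) := by
  intro x hx w
  constructor
  · refine mem_projUnobservable.2 ⟨K.Bc *ᵥ (P.C *ᵥ x + P.Gy *ᵥ w), ?_⟩
    rw [← h.Ahat_embed_add]
    exact Submodule.add_mem _ (Ahat_mulVec_mem _ hx) (h.Hhat_mulVec_mem w)
  · have h1 := h.output_eq_zero (x := x) (ξ := 0) hx
    have h2 := h.feedthrough_eq_zero w
    have := congrArg₂ (· + ·) h1 h2
    simp only [mulVec_zero, add_zero] at this
    rw [← this]
    simp only [mulVec_add]
    abel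

theorem hides_interUnobservable (h : IsDecouplingLoop τ P K) :
    P.Hides (P.interUnobservable K) := by
  intro x hx w h0
  have := (h.steers_interUnobservable x hx w).2
  rwa [h0, mulVec_zero, mulVec_zero, add_zero] at this

theorem isInputContaining_interUnobservable (h : IsDecouplingLoop τ P K) :
    IsInputContaining P.A P.H P.C P.Gy (P.interUnobservable K) := by
  refine isInputContaining_iff.2 fun x hx w h0 => ?_
  have h1 := Submodule.add_mem _ (Ahat_mulVec_mem _ hx) (h.Hhat_mulVec_mem w)
  rw [mulVecLin_apply, h.Ahat_embed_add, h0] at h1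
  simp only [mulVec_zero, add_zero] at h1
  exact h1

theorem Sst_le_interUnobservable (h : IsDecouplingLoop τ P K) :
    P.Sst ≤ P.interUnobservable K :=
  Sstar_le h.isInputContaining_interUnobservable

theorem Sst_le_Vst (h : IsDecouplingLoop τ P K) : P.Sst ≤ P.Vst :=
  h.Sst_le_interUnobservable.trans (interUnobservable_le.trans h.projUnobservable_le_Vst)

theorem hides_Sst (h : IsDecouplingLoop τ P K) : P.Hides P.Sst := fun x hx =>
  h.hides_interUnobservable x (h.Sst_le_interUnobservable hx)

theorem steers_Sst (h : IsDecouplingLoop τ P K) : P.Steers K.Dc P.Sst P.Vst := fun x hx w =>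
  have h1 := h.steers_interUnobservable x (h.Sst_le_interUnobservable hx) w
  ⟨h.projUnobservable_le_Vst h1.1, h1.2⟩

/-- Let `F` be a friend of `V⋆` that is stable on `V⋆ ⊓ S⋆`. The states that the stable closed loop
keeps unobservable are stable for `A + B F`: along the closed-loop motion both feedbacks agree
modulo `V⋆ ⊓ S⋆`. -/
theorem projUnobservable_le_stableSubspace (h : IsDecouplingLoop τ P K)
    {F : Matrix (Fin m) (Fin n) ℝ} (hF : IsOutputNullingFriend P.A P.B P.E P.Dz P.Vst F)
    (hR : P.Rst ≤ stableSubspace τ.stableRegion (P.A + P.B * F).mulVecLin) :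
    P.projUnobservable K ≤ stableSubspace τ.stableRegion (P.A + P.B * F).mulVecLin := by
  have hstab : eigs ((P.Ahat K).mulVecLin.restrict (Ahat_mulVec_mem (P := P) (K := K))) ⊆
      τ.stableRegion := by
    rw [eigs_restrict_subset_iff, eigs_subset_iff.1 h.stable]
    exact le_top
  rw [eigs_subset_iff] at hstab
  rintro _ ⟨v, hv, rfl⟩
  refine map_mem_stableSubspace
    (f := (P.Ahat K).mulVecLin.restrict (Ahat_mulVec_mem (P := P) (K := K)))
    (φ := LinearMap.funLeft ℝ ℝ Sum.inl ∘ₗ (P.unobservable K).subtype) (x := ⟨v, hv⟩)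
    (fun y => hR ?_) (hstab ▸ Submodule.mem_top)
  obtain ⟨y, hy⟩ := y
  obtain ⟨x, ξ, rfl⟩ : ∃ x ξ, y = Sum.elim x ξ := ⟨_, _, (Sum.elim_comp_inl_inr y).symm⟩
  have hx : x ∈ P.Vst := h.projUnobservable_le_Vst (mem_projUnobservable.2 ⟨ξ, hy⟩)
  have hout := h.output_eq_zero hy
  have hA := Ahat_mulVec_mem _ hy
  rw [mulVecLin_apply, Ahat_mulVec h.Dy_eq] at hA
  have hmem := h.projUnobservable_le_Vst (mem_projUnobservable.2 ⟨_, hA⟩)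
  have hFx := isOutputNullingFriend_iff.1 hF x hx
  set u := K.Dc *ᵥ (P.C *ᵥ x) + K.Cc *ᵥ ξ
  have e : (LinearMap.funLeft ℝ ℝ Sum.inl ∘ₗ (P.unobservable K).subtype)
      ((P.Ahat K).mulVecLin.restrict (Ahat_mulVec_mem (P := P) (K := K)) ⟨Sum.elim x ξ, hy⟩) -
      (P.A + P.B * F).mulVecLin
        ((LinearMap.funLeft ℝ ℝ Sum.inl ∘ₗ (P.unobservable K).subtype) ⟨Sum.elim x ξ, hy⟩) =
      P.B *ᵥ (u - F *ᵥ x) := by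
    change (P.Ahat K *ᵥ Sum.elim x ξ) ∘ Sum.inl - (P.A + P.B * F) *ᵥ x = _
    rw [Ahat_mulVec h.Dy_eq, Sum.elim_comp_inl, add_mulVec, ← mulVec_mulVec, mulVec_sub]
    abel
  rw [e]
  constructor
  · have h4 := Submodule.sub_mem _ hmem hFx.1
    rw [add_sub_add_left_eq_sub, ← mulVec_sub] at h4
    exact h4
  · have h0 : P.E *ᵥ (0 : Fin n → ℝ) + P.Dz *ᵥ (u - F *ᵥ x) = 0 := by
      rw [mulVec_zero, zero_add, mulVec_sub, ← add_sub_add_left_eq_sub _ _ (P.E *ᵥ x), hout,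
        hFx.2, sub_zero]
    have := isInputContaining_iff.1 (isInputContaining_Sstar (A := P.A) (B := P.B) (C := P.E)
      (D := P.Dz)) 0 (Submodule.zero_mem _) _ h0
    rwa [mulVec_zero, zero_add] at this

theorem Vm_le_stableSubspace (h : IsDecouplingLoop τ P K)
    {F : Matrix (Fin m) (Fin n) ℝ} (hF : IsOutputNullingFriend P.A P.B P.E P.Dz P.Vst F)
    (hR : P.Rst ≤ stableSubspace τ.stableRegion (P.A + P.B * F).mulVecLin) :
    P.Vm ≤ stableSubspace τ.stableRegion (P.A + P.B * F).mulVecLin := by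
  have hF' := isOutputNullingFriend_iff.1 hF
  refine (Vm_le (V := P.Vst ⊓ stableSubspace τ.stableRegion (P.A + P.B * F).mulVecLin)
    h.absorbs_Vst ?_ (le_inf inf_le_left hR) fun w => ?_).trans inf_le_right
  · refine isOutputNulling_iff.2 fun x hx => ⟨F *ᵥ x, ⟨(hF' x hx.1).1, ?_⟩, (hF' x hx.1).2⟩
    have := stableSubspace_invariant _ _ x hx.2
    rwa [mulVecLin_apply, add_mulVec, ← mulVec_mulVec] at this
  · obtain ⟨u, h1, h2⟩ := h.absorbs_projUnobservable w
    exact ⟨u, ⟨h.projUnobservable_le_Vst h1, h.projUnobservable_le_stableSubspace hF hR h1⟩, h2⟩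

/-- On `Vext` the disturbance can play the role of a feedback, and the resulting motion is followed
by the closed loop modulo its unobservable subspace. Hence the closed-loop characteristic polynomial
maps `Vext` into stable states. -/
theorem Vext_le_stableSubspace (h : IsDecouplingLoop τ P K)
    {F : Matrix (Fin m) (Fin n) ℝ} (hF : IsOutputNullingFriend P.A P.B P.E P.Dz P.Vst F)
    (hR : P.Rst ≤ stableSubspace τ.stableRegion (P.A + P.B * F).mulVecLin) :
    P.Vext ≤ stableSubspace τ.stableRegion (P.A + P.B * F).mulVecLin := by
  obtain ⟨L, hL⟩ : ∃ L, IsOutputNullingFriend P.A P.H (fromRows P.C P.E) (fromRows P.Gy P.Gz)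
      P.Vext L := IsOutputNulling.exists_friend isOutputNulling_Vstar
  have hL' := isOutputNullingFriend_iff.1 hL
  have hstep : ∀ x ∈ P.Vext, P.A *ᵥ x + P.H *ᵥ (L *ᵥ x) ∈ P.Vext ∧
      P.C *ᵥ x + P.Gy *ᵥ (L *ᵥ x) = 0 ∧ P.E *ᵥ x + P.Gz *ᵥ (L *ᵥ x) = 0 := by
    intro x hx
    have h2 := (hL' x hx).2
    rw [fromRows_mulVec, fromRows_mulVec] at h2
    exact ⟨(hL' x hx).1, funext fun i => congrFun h2 (Sum.inl i),
      funext fun i => congrFun h2 (Sum.inr i)⟩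
  have hT : ∀ x : P.Vext, (hL.restrict x : Fin n → ℝ) =
      P.A *ᵥ (x : Fin n → ℝ) + P.H *ᵥ (L *ᵥ (x : Fin n → ℝ)) := by
    intro x
    change (P.A + P.H * L) *ᵥ (x : Fin n → ℝ) = _
    rw [add_mulVec, ← mulVec_mulVec]
  set χ := (P.Ahat K).mulVecLin.charpoly with hχdef
  have hχ : IsStablePoly τ.stableRegion χ := isStablePoly_charpoly h.stable
  intro x hx
  have h1 := intertwine_aeval (f := hL.restrict) (g := (P.Ahat K).mulVecLin)
    (φ := embed n s ∘ₗ P.Vext.subtype) (Ahat_mulVec_mem (P := P) (K := K)) (fun y => by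
      have h2 := h.Ahat_embed_add y (L *ᵥ (y : Fin n → ℝ))
      rw [(hstep y y.2).2.1] at h2
      simp only [mulVec_zero, add_zero] at h2
      change embed n s (hL.restrict y : Fin n → ℝ) - P.Ahat K *ᵥ embed n s y ∈ _
      rw [hT, embed_apply, ← h2, add_sub_cancel_left]
      exact h.Hhat_mulVec_mem _) χ ⟨x, hx⟩
  rw [hχdef, LinearMap.aeval_self_charpoly, ← hχdef, LinearMap.zero_apply, sub_zero] at h1
  have h2 : ((aeval hL.restrict χ ⟨x, hx⟩ : P.Vext) : Fin n → ℝ) ∈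
      stableSubspace τ.stableRegion (P.A + P.B * F).mulVecLin :=
    h.projUnobservable_le_stableSubspace hF hR (interUnobservable_le h1)
  have h3 := intertwine_aeval (f := hL.restrict) (g := (P.A + P.B * F).mulVecLin)
    (φ := P.Vext.subtype) (stableSubspace_invariant τ.stableRegion _) (fun y => by
      refine h.Vm_le_stableSubspace hF hR ?_
      have hyV := Vext_le_Vst h.absorbs_Vst y.2
      have hFy := isOutputNullingFriend_iff.1 hF y hyV
      have hy := hstep y y.2
      have := sub_mem_Vm h.absorbs_Vst (x := y) (u₁ := 0) (w₁ := L *ᵥ (y : Fin n → ℝ))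
        (u₂ := F *ᵥ (y : Fin n → ℝ)) (w₂ := 0)
        (by simpa using Vext_le_Vst h.absorbs_Vst hy.1) (by simpa using hy.2.2)
        (by rw [mulVec_zero, add_zero]; exact hFy.1) (by rw [mulVec_zero, add_zero]; exact hFy.2)
      change (hL.restrict y : Fin n → ℝ) - (P.A + P.B * F) *ᵥ (y : Fin n → ℝ) ∈ _
      rw [hT, add_mulVec, ← mulVec_mulVec]
      simpa only [mulVec_zero, add_zero] using this) χ ⟨x, hx⟩
  exact mem_stableSubspace_of_aeval_mem hχ ((Submodule.sub_mem_iff_right _ h2).1 h3)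

theorem isInternallyStabilizable_of_le {V : Submodule ℝ (Fin n → ℝ)}
    {F : Matrix (Fin m) (Fin n) ℝ} (hF : IsOutputNullingFriend P.A P.B P.E P.Dz P.Vst F)
    (hV : IsOutputNulling P.A P.B P.E P.Dz V) (hRV : P.Rst ≤ V)
    (hstab : V ≤ stableSubspace τ.stableRegion (P.A + P.B * F).mulVecLin) :
    IsInternallyStabilizable τ P.A P.B P.E P.Dz V :=
  ⟨F, hF.of_le hV hRV, (hF.of_le hV hRV).eigs_restrict_subset_iff.2 hstab⟩

theorem isInternallyStabilizable_Vm (h : IsDecouplingLoop τ P K) :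
    IsInternallyStabilizable τ P.A P.B P.E P.Dz P.Vm := by
  obtain ⟨F, hF, hR⟩ := exists_friend_stable τ P.A P.B P.E P.Dz
  exact isInternallyStabilizable_of_le hF (isOutputNulling_Vm h.absorbs_Vst)
    (Rst_le_Vm h.absorbs_Vst) (h.Vm_le_stableSubspace hF hR)

theorem isInternallyStabilizable_Vm_sup_SM (h : IsDecouplingLoop τ P K) :
    IsInternallyStabilizable τ P.A P.B P.E P.Dz (P.Vm ⊔ P.SM) := by
  obtain ⟨F, hF, hR⟩ := exists_friend_stable τ P.A P.B P.E P.Dz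
  refine isInternallyStabilizable_of_le hF
    (isOutputNulling_Vm_sup_SM h.absorbs_Vst h.hides_Sst h.steers_Sst)
    ((Rst_le_Vm h.absorbs_Vst).trans le_sup_left)
    (sup_le (h.Vm_le_stableSubspace hF hR) ?_)
  rw [SM_eq h.hides_Sst]
  exact sup_le (h.Sst_le_interUnobservable.trans
    (interUnobservable_le.trans (h.projUnobservable_le_stableSubspace hF hR)))
    (h.Vext_le_stableSubspace hF hR)

end IsDecouplingLoop

/-! ### The dual plant -/

/-- The dual plant: all matrices are transposed, and the control and the disturbance change places
with the measurement and the controlled output. -/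
def dual (P : Plant n m q p r) : Plant n p r m q where
  A := P.Aᵀ
  B := P.Cᵀ
  H := P.Eᵀ
  C := P.Bᵀ
  Dy := P.Dyᵀ
  Gy := P.Dzᵀ
  E := P.Hᵀ
  Dz := P.Gyᵀ
  Gz := P.Gzᵀ

end Plant

open Matrix in
/-- The dual compensator. -/
def Compensator.dual {s m p : ℕ} (K : Compensator s m p) : Compensator s p m where
  Ac := K.Acᵀ
  Bc := K.Ccᵀ
  Cc := K.Bcᵀ
  Dc := K.Dcᵀ

namespace Plant

open Matrix

variable {n m q p r s : ℕ} {τ : TimeDomain} {P : Plant n m q p r} {K : Compensator s m p}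

theorem IsDecouplingLoop.dual (h : IsDecouplingLoop τ P K) :
    IsDecouplingLoop τ P.dual K.dual := by
  have hD : P.dual.Dy = 0 := by
    change P.Dyᵀ = 0
    rw [h.Dy_eq, transpose_zero]
  have hA : P.dual.Ahat K.dual = (P.Ahat K)ᵀ := by
    rw [Ahat_of_Dy_eq_zero hD, Ahat_of_Dy_eq_zero h.Dy_eq, fromBlocks_transpose]
    simp [Plant.dual, Compensator.dual, Matrix.mul_assoc]
  have hH : P.dual.Hhat K.dual = (P.Chat K)ᵀ := by
    rw [Hhat_of_Dy_eq_zero hD, Chat_of_Dy_eq_zero h.Dy_eq, transpose_fromCols]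
    simp [Plant.dual, Compensator.dual, Matrix.mul_assoc]
  have hC : P.dual.Chat K.dual = (P.Hhat K)ᵀ := by
    rw [Chat_of_Dy_eq_zero hD, Hhat_of_Dy_eq_zero h.Dy_eq, transpose_fromRows]
    simp [Plant.dual, Compensator.dual, Matrix.mul_assoc]
  have hG : P.dual.Ghat K.dual = (P.Ghat K)ᵀ := by
    rw [Ghat_of_Dy_eq_zero hD, Ghat_of_Dy_eq_zero h.Dy_eq]
    simp [Plant.dual, Compensator.dual, Matrix.mul_assoc]
  refine ⟨hD, by rw [hG, h.Ghat_eq, transpose_zero], fun k => ?_, ?_⟩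
  · rw [hC, hA, hH, ← transpose_pow, ← transpose_mul, ← transpose_mul, ← Matrix.mul_assoc,
      h.markov, transpose_zero]
  · rw [closedLoopSpectrum, hA, eigs_mulVecLin_transpose]
    exact h.stable

theorem perp_SM : perp P.SM = P.dual.Vm := by
  rw [SM, perp_Qstar, transpose_fromRows, transpose_fromRows]
  rfl

theorem IsDecouplingLoop.isInputContaining_SM (h : IsDecouplingLoop τ P K) :
    IsInputContaining P.A P.H P.C P.Gy P.SM := by
  rw [isInputContaining_iff_dual, perp_SM]
  exact isOutputNulling_Vm h.dual.absorbs_Vst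

theorem IsDecouplingLoop.isExternallyDetectable_SM (h : IsDecouplingLoop τ P K) :
    IsExternallyDetectable τ P.A P.H P.C P.Gy P.SM := by
  rw [isExternallyDetectable_iff_dual, perp_SM]
  exact h.dual.isInternallyStabilizable_Vm

end Plant

namespace Plant

open Matrix

variable {n m q p r s : ℕ}

/-! ### Removing the feedthrough from control to measurement -/

/-- The plant with the feedthrough `D_y` from the control to the measurement removed. -/
def withoutDy (P : Plant n m q p r) : Plant n m q p r :=
  { P with Dy := 0 }

/-- The compensator that produces with `P.withoutDy` the closed loop of `K` with `P`. -/
noncomputable def loopShift (P : Plant n m q p r) (K : Compensator s m p) :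
    Compensator s m p where
  Ac := K.Ac + K.Bc * P.W K * P.Dy * K.Cc
  Bc := K.Bc * P.W K
  Cc := K.Cc + K.Dc * P.W K * P.Dy * K.Cc
  Dc := K.Dc * P.W K

variable {P : Plant n m q p r} {K : Compensator s m p} {τ : TimeDomain}

theorem isDecouplingLoop_loopShift_iff : IsDecouplingLoop τ P.withoutDy (P.loopShift K) ↔
    P.IsDecoupled K ∧ P.closedLoopSpectrum K ⊆ τ.stableRegion := by
  have hD : P.withoutDy.Dy = 0 := rfl
  have hA : P.withoutDy.Ahat (P.loopShift K) = P.Ahat K := by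
    rw [Ahat_of_Dy_eq_zero hD]
    simp only [Ahat, withoutDy, loopShift, Matrix.mul_add, Matrix.mul_assoc]
  have hH : P.withoutDy.Hhat (P.loopShift K) = P.Hhat K := by
    rw [Hhat_of_Dy_eq_zero hD]
    simp only [Hhat, withoutDy, loopShift, Matrix.mul_assoc]
  have hC : P.withoutDy.Chat (P.loopShift K) = P.Chat K := by
    rw [Chat_of_Dy_eq_zero hD]
    simp only [Chat, withoutDy, loopShift, Matrix.mul_add, Matrix.mul_assoc]
  have hG : P.withoutDy.Ghat (P.loopShift K) = P.Ghat K := by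
    rw [Ghat_of_Dy_eq_zero hD]
    simp only [Ghat, withoutDy, loopShift, Matrix.mul_assoc]
  rw [isDecoupled_iff]
  constructor
  · rintro ⟨-, h1, h2, h3⟩
    rw [hA, hH, hC] at h2
    rw [closedLoopSpectrum, hA] at h3
    exact ⟨⟨hG ▸ h1, h2⟩, h3⟩
  · rintro ⟨⟨h1, h2⟩, h3⟩
    refine ⟨hD, hG ▸ h1, ?_, ?_⟩
    · rw [hA, hH, hC]; exact h2
    · rw [closedLoopSpectrum, hA]; exact h3

theorem isUnit_one_add_mul_Dy (h : P.WellPosed K) :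
    IsUnit (1 + (P.loopShift K).Dc * P.Dy).det := by
  have hW : P.W K * (1 - P.Dy * K.Dc) = 1 := Matrix.nonsing_inv_mul _ h
  refine Matrix.isUnit_det_of_right_inverse (B := 1 - K.Dc * P.Dy) ?_
  have e : (1 + K.Dc * P.W K * P.Dy) * (1 - K.Dc * P.Dy) =
      1 - K.Dc * P.Dy + K.Dc * (P.W K * (1 - P.Dy * K.Dc)) * P.Dy := by
    simp only [Matrix.add_mul, Matrix.mul_sub, Matrix.sub_mul, Matrix.mul_one, Matrix.one_mul,
      Matrix.mul_assoc]
    abel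
  change (1 + K.Dc * P.W K * P.Dy) * (1 - K.Dc * P.Dy) = 1
  rw [e, hW, Matrix.mul_one, sub_add_cancel]

/-- Every compensator whose feedthrough `K.Dc` leaves `1 + K.Dc * D_y` non-singular arises from a
well posed one. -/
theorem exists_loopShift_eq (P : Plant n m q p r) (K : Compensator s m p)
    (h : IsUnit (1 + K.Dc * P.Dy).det) :
    ∃ K' : Compensator s m p, P.WellPosed K' ∧ P.loopShift K' = K := by
  obtain ⟨M, hM⟩ : ∃ M, M = (1 + K.Dc * P.Dy)⁻¹ := ⟨_, rfl⟩
  have hM1 : (1 + K.Dc * P.Dy) * M = 1 := hM ▸ Matrix.mul_nonsing_inv _ h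
  have hM2 : M * (1 + K.Dc * P.Dy) = 1 := hM ▸ Matrix.nonsing_inv_mul _ h
  have hinv : (1 - P.Dy * (M * K.Dc)) * (1 + P.Dy * K.Dc) = 1 := by
    have e : (1 - P.Dy * (M * K.Dc)) * (1 + P.Dy * K.Dc) =
        1 + P.Dy * K.Dc - P.Dy * (M * (1 + K.Dc * P.Dy)) * K.Dc := by
      simp only [Matrix.mul_add, Matrix.add_mul, Matrix.sub_mul, Matrix.mul_assoc,
        Matrix.mul_one, Matrix.one_mul]
      abel
    rw [e, hM2, Matrix.mul_one, add_sub_cancel_right]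
  let K' : Compensator s m p :=
    { Ac := K.Ac - K.Bc * P.Dy * (M * K.Cc)
      Bc := K.Bc * (1 - P.Dy * (M * K.Dc))
      Cc := M * K.Cc
      Dc := M * K.Dc }
  have hW : P.W K' = 1 + P.Dy * K.Dc := Matrix.inv_eq_right_inv hinv
  have hB : K'.Bc * P.W K' = K.Bc := by
    rw [hW]
    change K.Bc * (1 - P.Dy * (M * K.Dc)) * (1 + P.Dy * K.Dc) = K.Bc
    rw [Matrix.mul_assoc, hinv, Matrix.mul_one]
  have hD : K'.Dc * P.W K' = K.Dc := by
    rw [hW]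
    change M * K.Dc * (1 + P.Dy * K.Dc) = K.Dc
    have e : M * K.Dc * (1 + P.Dy * K.Dc) = M * (1 + K.Dc * P.Dy) * K.Dc := by
      simp only [Matrix.mul_add, Matrix.add_mul, Matrix.mul_assoc, Matrix.mul_one]
    rw [e, hM2, Matrix.one_mul]
  refine ⟨K', Matrix.isUnit_det_of_right_inverse hinv, ?_⟩
  have hC : M * K.Cc + K.Dc * P.Dy * (M * K.Cc) = K.Cc := by
    have e : M * K.Cc + K.Dc * P.Dy * (M * K.Cc) = (1 + K.Dc * P.Dy) * M * K.Cc := by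
      simp only [Matrix.add_mul, Matrix.one_mul, Matrix.mul_assoc]
    rw [e, hM1, Matrix.one_mul]
  rw [loopShift, hB, hD]
  change Compensator.mk (K.Ac - K.Bc * P.Dy * (M * K.Cc) + K.Bc * P.Dy * (M * K.Cc)) K.Bc
    (M * K.Cc + K.Dc * P.Dy * (M * K.Cc)) K.Dc = K
  rw [sub_add_cancel, hC]

/-! ### Sufficiency -/

section Observer

/-- The observer-based compensator with state feedback `F`, output injection `G` and feedthrough
`L`. -/
def observer (P : Plant n m q p r) (F : Matrix (Fin m) (Fin n) ℝ) (G : Matrix (Fin n) (Fin p) ℝ)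
    (L : Matrix (Fin m) (Fin p) ℝ) : Compensator n m p where
  Ac := P.A + P.B * F + G * P.C - P.B * L * P.C
  Bc := P.B * L - G
  Cc := F - L * P.C
  Dc := L

variable {F : Matrix (Fin m) (Fin n) ℝ} {G : Matrix (Fin n) (Fin p) ℝ}
  {L : Matrix (Fin m) (Fin p) ℝ}

/-- In terms of the plant state `x` and the estimation error `e`, the closed loop is
block triangular. -/
theorem observer_Ahat_mulVec (h : P.Dy = 0) (x e : Fin n → ℝ) :
    P.Ahat (P.observer F G L) *ᵥ Sum.elim x (x - e) =
      Sum.elim (P.A *ᵥ (x - e) + P.B *ᵥ (F *ᵥ (x - e)) +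
          (P.A *ᵥ e + P.B *ᵥ (L *ᵥ (P.C *ᵥ e))))
        (P.A *ᵥ (x - e) + P.B *ᵥ (F *ᵥ (x - e)) +
          (P.A *ᵥ e + P.B *ᵥ (L *ᵥ (P.C *ᵥ e))) - (P.A *ᵥ e + G *ᵥ (P.C *ᵥ e))) := by
  rw [Ahat_mulVec h]
  congr 1
  · simp only [observer, sub_mulVec, mulVec_sub, mulVec_add, ← mulVec_mulVec]
    abel
  · simp only [observer, sub_mulVec, add_mulVec, mulVec_sub, ← mulVec_mulVec]
    abel

/-- The separation principle. -/
theorem observer_stable (h : P.Dy = 0)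
    (hF : stableSubspace τ.stableRegion (P.A + P.B * F).mulVecLin = ⊤)
    (hG : stableSubspace τ.stableRegion (P.A + G * P.C).mulVecLin = ⊤) :
    P.closedLoopSpectrum (P.observer F G L) ⊆ τ.stableRegion := by
  rw [closedLoopSpectrum, eigs_subset_iff, eq_top_iff]
  intro v _
  let err : (Fin n ⊕ Fin n → ℝ) →ₗ[ℝ] (Fin n → ℝ) :=
    LinearMap.funLeft ℝ ℝ Sum.inl - LinearMap.funLeft ℝ ℝ Sum.inr
  let diag : (Fin n → ℝ) →ₗ[ℝ] (Fin n ⊕ Fin n → ℝ) :=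
    LinearMap.funLeft ℝ ℝ (Sum.elim id id)
  have herr : ∀ y, err ((P.Ahat (P.observer F G L)).mulVecLin y) =
      (P.A + G * P.C).mulVecLin (err y) := by
    intro y
    obtain ⟨x, e, rfl⟩ : ∃ x e, y = Sum.elim x (x - e) :=
      ⟨y ∘ Sum.inl, y ∘ Sum.inl - y ∘ Sum.inr, by
        rw [sub_sub_cancel, Sum.elim_comp_inl_inr]⟩
    have he : err (Sum.elim x (x - e)) = e := by
      change x - (x - e) = e
      rw [sub_sub_cancel]
    rw [mulVecLin_apply, observer_Ahat_mulVec h, he, mulVecLin_apply, add_mulVec, ← mulVec_mulVec]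
    exact sub_sub_cancel _ _
  have hdiag : ∀ x, diag ((P.A + P.B * F).mulVecLin x) =
      (P.Ahat (P.observer F G L)).mulVecLin (diag x) := by
    intro x
    have e : ∀ y : Fin n → ℝ, diag y = Sum.elim y (y - 0) := by
      intro y
      rw [sub_zero]
      ext i
      cases i <;> rfl
    rw [e, e, mulVecLin_apply, mulVecLin_apply, observer_Ahat_mulVec h]
    simp only [sub_zero, mulVec_zero, add_zero, add_mulVec, ← mulVec_mulVec]
  obtain ⟨χ, hχ, h0⟩ : err v ∈ stableSubspace τ.stableRegion (P.A + G * P.C).mulVecLin :=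
    hG ▸ Submodule.mem_top
  refine mem_stableSubspace_of_aeval_mem hχ ?_
  set v' := aeval (P.Ahat (P.observer F G L)).mulVecLin χ v with hv'
  have h1 : err v' = 0 := by
    have := intertwine_aeval (g := (P.A + G * P.C).mulVecLin) (φ := err) (L := ⊥) (by simp)
      (fun y => by rw [herr, sub_self]; exact Submodule.zero_mem _) χ v
    rwa [h0, sub_zero, Submodule.mem_bot] at this
  have h2 : diag (v' ∘ Sum.inl) = v' := by
    ext i
    cases i with
    | inl i => rfl
    | inr i => exact sub_eq_zero.1 (congrFun h1 i)
  rw [← h2]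
  refine map_mem_stableSubspace (f := (P.A + P.B * F).mulVecLin) (φ := diag) (fun x => ?_)
    (hF ▸ Submodule.mem_top)
  rw [hdiag, sub_self]
  exact Submodule.zero_mem _

/-- The observer-based compensator built from a friend of `V` and a friend of `S ≤ V` decouples,
because the plant state stays in `V` and the estimation error stays in `S`. -/
theorem observer_isDecouplingLoop (h : P.Dy = 0) {V S : Submodule ℝ (Fin n → ℝ)} (hSV : S ≤ V)
    (hV : IsOutputNullingFriend P.A P.B P.E P.Dz V F)
    (hS : IsInputContainingFriend P.A P.H P.C P.Gy S G) (hL : P.Steers L S V)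
    (hF : stableSubspace τ.stableRegion (P.A + P.B * F).mulVecLin = ⊤)
    (hG : stableSubspace τ.stableRegion (P.A + G * P.C).mulVecLin = ⊤) :
    IsDecouplingLoop τ P (P.observer F G L) := by
  rw [isOutputNullingFriend_iff] at hV
  rw [isInputContainingFriend_iff] at hS
  have hL0 : ∀ e ∈ S, P.A *ᵥ e + P.B *ᵥ (L *ᵥ (P.C *ᵥ e)) ∈ V ∧
      P.E *ᵥ e + P.Dz *ᵥ (L *ᵥ (P.C *ᵥ e)) = 0 := fun e he => by
    simpa only [mulVec_zero, add_zero] using hL e he 0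
  have hL1 : ∀ w, P.B *ᵥ (L *ᵥ (P.Gy *ᵥ w)) + P.H *ᵥ w ∈ V ∧
      P.Dz *ᵥ (L *ᵥ (P.Gy *ᵥ w)) + P.Gz *ᵥ w = 0 := fun w => by
    simpa only [mulVec_zero, zero_add] using hL 0 S.zero_mem w
  have hinv : ∀ k : ℕ, ∀ x ∈ V, ∀ e ∈ S, ∃ x' ∈ V, ∃ e' ∈ S,
      (P.Ahat (P.observer F G L) ^ k) *ᵥ Sum.elim x (x - e) = Sum.elim x' (x' - e') := by
    intro k
    induction k with
    | zero => exact fun x hx e he => ⟨x, hx, e, he, by rw [pow_zero, one_mulVec]⟩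
    | succ k ih =>
      intro x hx e he
      rw [pow_succ, ← mulVec_mulVec, observer_Ahat_mulVec h]
      exact ih _ (V.add_mem (hV _ (V.sub_mem hx (hSV he))).1 (hL0 e he).1) _ (hS.1 e he)
  have hout : ∀ x ∈ V, ∀ e ∈ S,
      P.Chat (P.observer F G L) *ᵥ Sum.elim x (x - e) = 0 := by
    intro x hx e he
    rw [Chat_mulVec h]
    have := congrArg₂ (· + ·) (hV _ (V.sub_mem hx (hSV he))).2 (hL0 e he).2
    simp only [add_zero] at this
    rw [← this]
    simp only [observer, sub_mulVec, mulVec_sub, mulVec_add, ← mulVec_mulVec]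
    abel
  have hdist : ∀ w, P.Hhat (P.observer F G L) *ᵥ w =
      Sum.elim (P.B *ᵥ (L *ᵥ (P.Gy *ᵥ w)) + P.H *ᵥ w)
        (P.B *ᵥ (L *ᵥ (P.Gy *ᵥ w)) + P.H *ᵥ w - (P.H *ᵥ w + G *ᵥ (P.Gy *ᵥ w))) := by
    intro w
    rw [Hhat_mulVec h]
    congr 1
    · exact add_comm _ _
    · simp only [observer, sub_mulVec, ← mulVec_mulVec]
      abel
  refine ⟨h, ?_, fun k => ?_, observer_stable h hF hG⟩
  · refine Matrix.ext_of_mulVec_single fun i => ?_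
    rw [Ghat_mulVec h, zero_mulVec, add_comm]
    exact (hL1 _).2
  · refine Matrix.ext_of_mulVec_single fun i => ?_
    obtain ⟨x', hx', e', he', hk⟩ := hinv k _ (hL1 (Pi.single i 1)).1 _ (hS.2 (Pi.single i 1))
    rw [Matrix.mul_assoc, ← mulVec_mulVec, ← mulVec_mulVec, hdist, hk, hout x' hx' e' he',
      zero_mulVec]

end Observer

end Plant

end GeometricControl

open GeometricControl in
theorem mainTheorem1 (τ : TimeDomain) (n m q p r : ℕ) (P : Plant n m q p r)
    (hstab : IsStabilizable τ P.A P.B) (hdet : IsDetectable τ P.C P.A) :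
    P.DDPStableSolvable τ ↔
      ∃ K : Matrix (Fin m) (Fin p) ℝ,
        -- (A)
        LinearMap.range (P.H.mulVecLin.prod P.Gz.mulVecLin) ≤
          P.Vst.prod (⊥ : Submodule ℝ (Fin r → ℝ)) ⊔
            LinearMap.range (P.B.mulVecLin.prod P.Dz.mulVecLin) ∧
        -- (B)
        P.Sst.prod (⊤ : Submodule ℝ (Fin q → ℝ)) ⊓
            LinearMap.ker (P.C.mulVecLin.coprod P.Gy.mulVecLin) ≤
          LinearMap.ker (P.E.mulVecLin.coprod P.Gz.mulVecLin) ∧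
        -- (C)
        P.Sst ≤ P.Vst ∧
        -- (D)
        (IsOutputNulling P.A P.B P.E P.Dz (P.Vm ⊔ P.SM) ∧
          IsInternallyStabilizable τ P.A P.B P.E P.Dz (P.Vm ⊔ P.SM)) ∧
        -- (E)
        (IsInputContaining P.A P.H P.C P.Gy P.SM ∧
          IsExternallyDetectable τ P.A P.H P.C P.Gy P.SM) ∧
        -- (F)
        (IsUnit (1 + K * P.Dy).det ∧
          (P.Sst.prod (⊤ : Submodule ℝ (Fin q → ℝ))).map (P.feedbackBlock K) ≤
            P.Vst.prod (⊥ : Submodule ℝ (Fin r → ℝ))) := by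
  constructor
  · rintro ⟨s, K, hwp, hdec, hst⟩
    have h := Plant.isDecouplingLoop_loopShift_iff.2 ⟨hdec, hst⟩
    exact ⟨(P.loopShift K).Dc, P.absorbs_iff.1 h.absorbs_Vst, P.hides_iff.1 h.hides_Sst,
      h.Sst_le_Vst,
      ⟨Plant.isOutputNulling_Vm_sup_SM h.absorbs_Vst h.hides_Sst h.steers_Sst,
        h.isInternallyStabilizable_Vm_sup_SM⟩,
      ⟨h.isInputContaining_SM, h.isExternallyDetectable_SM⟩,
      Plant.isUnit_one_add_mul_Dy hwp, P.steers_iff.1 h.steers_Sst⟩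
  · rintro ⟨K, hA, hB, -, ⟨-, hD⟩, ⟨-, hE⟩, hU, hF⟩
    obtain ⟨F, hF₁, hF₂⟩ := hD.exists_stable_friend hstab
    obtain ⟨G, hG₁, hG₂⟩ := hE.exists_stable_friend hdet
    have hloop : Plant.IsDecouplingLoop τ P.withoutDy (P.withoutDy.observer F G K) :=
      Plant.observer_isDecouplingLoop (P := P.withoutDy) rfl (le_sup_right (a := P.Vm)) hF₁ hG₁
        (Plant.steers_SM (P := P.withoutDy) (P.absorbs_iff.2 hA) (P.hides_iff.2 hB)
          (P.steers_iff.2 hF)) hF₂ hG₂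
    obtain ⟨K', hwp, hK'⟩ := P.exists_loopShift_eq (P.withoutDy.observer F G K) hU
    rw [← hK', Plant.isDecouplingLoop_loopShift_iff] at hloop
    exact ⟨n, K', hwp, hloop⟩
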